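/- Let $d\ge 1$ and let $p$ be a translation invariant, symmetric, irreducible, finite range Markov transition function on $\mathbb Z^d$. Let $\{\eta(t):t\ge0\}$ be the system of independent random walkers on $\mathbb Z^d$ (each particle, independently of all others, jumps from $i$ to $j$ at rate $p(i,j)$; $\eta_x(t)$ is the number of particles at $x$ at time $t$), started from the product measure $\nu_\rho$ with Poisson marginals of mean $\rho>0$; $\mathbb E_{\nu_\rho}$ denotes expectation for this process. Fix a Schwartz function $\phi:\mathbb R^d\to\mathbb R$ and, for $N\in\mathbb N$, $N\geq 1$, put $$X_N^{(2)}(\eta;\phi)=\sum_{x\in\mathbb Z^d}\phi(x/N)\,D(2\delta_x,\eta),\qquad D(2\delta_x,\eta)=\eta_x(\eta_x-1)-2\rho(\eta_x-\rho)-\rho^2 ,$$ the field of the second order (monic) Charlier polynomial. For a local function $f$ put $\psi_f(r)=\int f\,d\nu_r$, $P_1(f)(\eta)=\psi_f'(\rho)(\eta_0-\rho)$ and $\mathsf X_N(f,\eta;\phi)=\sum_{x}\phi(x/N)\,(f(\tau_x\eta)-\psi_f(\rho))$ with $(\tau_x\eta)_y=\eta_{y+x}$. Then there are constants $C(T)$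 and $K$, depending only on $d,p,\rho,\phi$ and, for $C(T)$, on $T$, such that the following hold. (1) For all $T>0$ and all $N$ large enough (depending on $T$), the variables $X_N^{(2)}(\eta(N^2t);\phi)$, $t\ge0$, are square integrable, their covariance is integrable over $[0,T]^2$, and $$\frac1{N^d}\int_0^T\!\!\int_0^T\mathbb E_{\nu_\rho}\!\left[X_N^{(2)}(\eta(N^2t);\phi)\,X_N^{(2)}(\eta(N^2s);\phi)\right]ds\,dt\;\le\; C(T)\,N^{-\frac{2d}{2+d}} .$$ (2) (Quantitative Boltzmann-Gibbs principle for $f(\eta)=\eta_0(\eta_0-1)$.) For all $T>0$ and all $N$ large enough (depending on $T$), almost surely $t\mapsto \mathsf X_N(f,\eta(N^2t);\phi)-\mathsf X_N(P_1(f),\eta(N^2t);\phi)$ is integrable on $[0,T]$, its time integral is square integrable, and $$\mathbb E_{\nu_\rho}\!\left[\left(\frac1{N^{d/2}}\int_0^T\big(\mathsf X_N(f,\eta(N^2t);\phi)-\mathsf X_N(P_1(f),\eta(N^2t);\phi)\big)\,dt\right)^{2}\right]\;\le\; C(T)\,N^{-\frac{2d}{2+d}} .$$ (3) At distinct macroscopic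 times the covariance is of order one: for all $N$ large enough and all $s,t\ge0$ with $s\ne t$, $$\left|\mathbb E_{\nu_\rho}\!\left[X_N^{(2)}(\eta(N^2t);\phi)\,X_N^{(2)}(\eta(N^2s);\phi)\right]\right|\le \frac{K}{|t-s|^{d}} .$$ -/

import Mathlib

open MeasureTheory ProbabilityTheory Filter Topology
open scoped NNReal SchwartzMap

noncomputable section

/-! ### Lattice, configurations, single-particle kernel -/

/-- The lattice `ℤ^d`. -/
abbrev Site (d : ℕ) : Type := Fin d → ℤ

/-- Particle configurations: `η x` is the number of particles at the site `x`. -/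
abbrev Config (d : ℕ) : Type := Site d → ℕ

/-- A translation invariant, symmetric, irreducible, finite range Markov transition function
on `ℤ^d`. (The norm on `Site d` is the maximum norm; the choice of the norm is immaterial.) -/
structure IsJumpKernel {d : ℕ} (p : Site d → Site d → ℝ) : Prop where
  nonneg : ∀ i j, 0 ≤ p i j
  symm : ∀ i j, p i j = p j i
  transl : ∀ i j, p i j = p 0 (j - i)
  sum_one : ∀ i, HasSum (p i) 1
  finite_range : ∃ R : ℝ, 0 < R ∧ ∀ i j : Site d, R < ‖i - j‖ → p i j = 0
  irreducible : ∀ x y, Relation.ReflTransGen (fun a b => 0 < p a b) x y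

/-- The `n`-step transition probabilities of the discrete-time walk with transition function `p`. -/
def stepProb {d : ℕ} (p : Site d → Site d → ℝ) : ℕ → Site d → Site d → ℝ
  | 0 => fun x y => if x = y then 1 else 0
  | n + 1 => fun x y => ∑' z, p x z * stepProb p n z y

/-- Transition probabilities `p_t(x,y) = ∑ₙ e^{-t} tⁿ/n! pⁿ(x,y)` of the continuous-time random walk
that jumps from `i` to `j` at rate `p(i,j)`, i.e. the kernel of `exp (t (p - 1))`. -/
def heatKernel {d : ℕ} (p : Site d → Site d → ℝ) (t : ℝ) (x y : Site d) : ℝ :=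
  ∑' n : ℕ, Real.exp (-t) * t ^ n / (n.factorial : ℝ) * stepProb p n x y

/-! ### The process -/

/-- `X` is a continuous-time random walk on `ℤ^d` started at the origin that jumps from `i` to `j`
at rate `p(i,j)`: it has independent increments, the increment over `[s,t]` has law
`p_{t-s}(0,·)`, and its paths are right-continuous with left limits in the discrete space `ℤ^d`. -/
structure IsContinuousTimeWalk {d : ℕ} {Ω : Type*} [MeasurableSpace Ω] (P : Measure Ω)
    (p : Site d → Site d → ℝ) (X : ℝ≥0 → Ω → Site d) : Prop where
  measurable : ∀ t, Measurable (X t)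
  start : ∀ ω, X 0 ω = 0
  indep : HasIndepIncrements X P
  increment_law : ∀ s t : ℝ≥0, s ≤ t → ∀ x : Site d,
    P.real {ω | X t ω - X s ω = x} = heatKernel p ((t : ℝ) - (s : ℝ)) 0 x
  right_cont : ∀ ω t, ∀ᶠ u in 𝓝[>] t, X u ω = X t ω
  left_lim : ∀ ω t, ∃ x, ∀ᶠ u in 𝓝[<] t, X u ω = x

/-- The homogeneous product measure `ν_ρ` on configurations with Poisson marginals of mean `ρ`. -/
def poissonProduct (d : ℕ) (ρ : ℝ≥0) : Measure (Config d) :=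
  Measure.infinitePi fun _ : Site d => poissonMeasure ρ

/-- The system of independent random walkers with jump kernel `p` started from `ν_ρ`.
The initial configuration `η₀` has law `ν_ρ`; the particles initially at `z` carry the labels
`(z,k)` with `k < η₀ z`; the displacements `W i` of the particles are independent
continuous-time random walks, independent of `η₀`. -/
structure IsIndependentWalkers {d : ℕ} {Ω : Type*} [MeasurableSpace Ω] (P : Measure Ω)
    (p : Site d → Site d → ℝ) (ρ : ℝ≥0) (η₀ : Ω → Config d)
    (W : Site d × ℕ → ℝ≥0 → Ω → Site d) : Prop where
  measurable_init : Measurable η₀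
  init_law : P.map η₀ = poissonProduct d ρ
  walk : ∀ i, IsContinuousTimeWalk P p (W i)
  walks_indep : iIndepFun (fun (i : Site d × ℕ) (ω : Ω) (t : ℝ≥0) => W i t ω) P
  init_indep : IndepFun η₀ (fun (ω : Ω) (i : Site d × ℕ) (t : ℝ≥0) => W i t ω) P

/-- The configuration `η(t)` at time `t`: `η_x(t)` is the number of particles `(z,k)`, `k < η₀ z`,
whose position `z + W (z,k) t` at time `t` is `x`. -/
def walkersConfig {d : ℕ} {Ω : Type*} (η₀ : Ω → Config d) (W : Site d × ℕ → ℝ≥0 → Ω → Site d)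
    (t : ℝ≥0) (ω : Ω) : Config d :=
  fun x => Set.ncard {i : Site d × ℕ | i.2 < η₀ ω i.1 ∧ i.1 + W i t ω = x}

/-- The diffusively rescaled configuration `η(N² t)`, `t ≥ 0`. -/
def diffusiveConfig {d : ℕ} {Ω : Type*} (η₀ : Ω → Config d) (W : Site d × ℕ → ℝ≥0 → Ω → Site d)
    (N : ℕ) (t : ℝ) (ω : Ω) : Config d :=
  walkersConfig η₀ W (Real.toNNReal ((N : ℝ) ^ 2 * t)) ω

/-! ### Orthogonal duality polynomials and fluctuation fields -/

/-- Single-site (monic) Charlier polynomial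
`∑_{j ≤ k} (k choose j) (-ρ)^{k-j} n!/(n-j)!`. -/
def charlier (ρ : ℝ≥0) (k n : ℕ) : ℝ :=
  ∑ j ∈ Finset.range (k + 1),
    (k.choose j : ℝ) * (-(ρ : ℝ)) ^ (k - j) * (n.descFactorial j : ℝ)

/-- The orthogonal self-duality function `D(ξ,η) = ∏_x d(ξ_x, η_x)`, for finite `ξ`. -/
def dualityPoly {d : ℕ} (ρ : ℝ≥0) (ξ : Site d →₀ ℕ) (η : Config d) : ℝ :=
  ξ.prod fun x k => charlier ρ k (η x)

/-- `D(2δ_x, η) = η_x (η_x - 1) - 2ρ (η_x - ρ) - ρ²`. -/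
theorem dualityPoly_two {d : ℕ} (ρ : ℝ≥0) (x : Site d) (η : Config d) :
    dualityPoly ρ (Finsupp.single x 2) η =
      (η x : ℝ) * ((η x : ℝ) - 1) - 2 * (ρ : ℝ) * ((η x : ℝ) - (ρ : ℝ)) - (ρ : ℝ) ^ 2 := by
  have h0 : charlier ρ 0 (η x) = 1 := by simp [charlier]
  have h2 : ((η x).descFactorial 2 : ℝ) = (η x : ℝ) * ((η x : ℝ) - 1) := by
    cases η x with
    | zero => simp [Nat.descFactorial]
    | succ m => simp [Nat.descFactorial]; ring
  have hD : dualityPoly ρ (Finsupp.single x 2) η = charlier ρ 2 (η x) :=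
    Finsupp.prod_single_index (h := fun x k => charlier ρ k (η x)) h0
  rw [hD, charlier]
  simp only [Finset.sum_range_succ, Finset.sum_range_zero, h2, Nat.descFactorial_zero,
    Nat.descFactorial_one, Nat.choose_self, Nat.choose_zero_right, Nat.choose_one_right]
  norm_num
  ring

/-- The point `x / N` of `ℝ^d`. -/
def scaledPoint {d : ℕ} (N : ℕ) (x : Site d) : EuclideanSpace ℝ (Fin d) :=
  WithLp.toLp 2 fun i => (x i : ℝ) / (N : ℝ)

/-- The second order polynomial field `X_N^{(2)}(η;φ) = ∑_x φ(x/N) D(2δ_x, η)`. -/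
def secondOrderField {d : ℕ} (ρ : ℝ≥0) (N : ℕ) (φ : 𝓢(EuclideanSpace ℝ (Fin d), ℝ))
    (η : Config d) : ℝ :=
  ∑' x : Site d, φ (scaledPoint N x) * dualityPoly ρ (Finsupp.single x 2) η

/-- The mean `ψ_f(r) = ∫ f dν_r`, as a function of the density `r ≥ 0`. -/
def meanAt {d : ℕ} (f : Config d → ℝ) (r : ℝ) : ℝ :=
  ∫ η, f η ∂(poissonProduct d r.toNNReal)

/-- The fluctuation field `X_N(f,η;φ) = ∑_x φ(x/N) (f(τ_x η) - ψ_f(ρ))`, where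
`(τ_x η)_y = η_{y+x}`, with normalization constant one. -/
def fluctuationField {d : ℕ} (ρ : ℝ≥0) (N : ℕ) (f : Config d → ℝ)
    (φ : 𝓢(EuclideanSpace ℝ (Fin d), ℝ)) (η : Config d) : ℝ :=
  ∑' x : Site d, φ (scaledPoint N x) * (f (fun y => η (y + x)) - meanAt f ρ)

/-- The projection `P_1(f)(η) = ψ_f'(ρ) (η_0 - ρ)` of `f` on the density field. -/
def densityProjection {d : ℕ} (ρ : ℝ≥0) (f : Config d → ℝ) (η : Config d) : ℝ :=
  deriv (meanAt f) (ρ : ℝ) * ((η 0 : ℝ) - (ρ : ℝ))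

/-- The local function `f(η) = η_0 (η_0 - 1)`. -/
def pairFunction {d : ℕ} (η : Config d) : ℝ := (η 0 : ℝ) * ((η 0 : ℝ) - 1)

end

/-! Everything rests on the exact covariance, for `s ≤ t`, of $D(2\delta_x,\eta(t))$ and
$D(2\delta_y,\eta(s))$: it equals $2\rho^2 p_{t-s}(x,y)^2$
(`IsIndependentWalkers.integral_charlierTwo_mul`). The particles at $y$ at time $s$ and at $x$ at
time $t$ form a Poisson number $A$ of mean $a=\rho\,p_{t-s}(x,y)$. The two occupation numbers are
$A+B$ and $A+C$ with independent Poisson variables $A$, $B$, $C$. Averaging out $B$ and $C$ turns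
the Charlier polynomial of parameter $\rho$ into the one of parameter $a$ at $A$, whose variance is
$2a^2$.

The covariance of the fields is therefore $2\rho^2\sum_{x,y}\phi(x/N)\phi(y/N)\,p(x,y)^2$. If $p\le
B$, bounding one factor $p$ by $B$ and summing the other to one gives order $N^dB$; bounding both
gives order $N^{2d}B^2$ (`IsIndependentWalkers.abs_covariance_le_of_le`). The heat kernel estimate
$B=c\,(N^2|t-s|)^{-d/2}$ comes from Fourier inversion, irreducibility making $1-\hat p$ coercive
(`IsJumpKernel.exists_heatKernel_le`).

The $N^{2d}B^2$ bound is part (3). For part (1), use $B=1$ on the strip $|t-s|<\varepsilon$ and the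
heat kernel estimate off it. After division by $N^d$ the costs are of order $\varepsilon$ and
$(N^2\varepsilon)^{-d/2}$, which agree exactly when $\varepsilon=N^{-2d/(2+d)}$.

For part (2), $\psi_f(r)=r^2$, so $f-\psi_f(\rho)-P_1(f)$ is the second Charlier polynomial. By
Fubini, the second moment of the time integral is the double integral of part (1). -/

noncomputable section

/-! ### Fourier analysis of the heat kernel -/

/-- The pairing `∑ j, x_j θ_j` of a lattice site and a frequency. -/
def phase {d : ℕ} (x : Site d) (θ : Fin d → ℝ) : ℝ := ∑ j, (x j : ℝ) * θ j

/-- The characteristic function `∑_z p(0,z) cos (z·θ)` of the jump distribution. -/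
def jumpCharFun {d : ℕ} (p : Site d → Site d → ℝ) (θ : Fin d → ℝ) : ℝ :=
  ∑' z, p 0 z * Real.cos (phase z θ)

/-- Lebesgue measure on the torus `(-π, π]^d`. -/
def torusMeasure (d : ℕ) : Measure (Fin d → ℝ) :=
  Measure.pi fun _ => volume.restrict (Set.Ioc (-Real.pi) Real.pi)

section HeatKernel

variable {d : ℕ} {p : Site d → Site d → ℝ}

instance : IsFiniteMeasure (volume.restrict (Set.Ioc (-Real.pi) Real.pi)) :=
  ⟨by simp⟩

instance : IsFiniteMeasure (torusMeasure d) := by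
  unfold torusMeasure; infer_instance

lemma phase_zero (θ : Fin d → ℝ) : phase 0 θ = 0 := by simp [phase]

lemma phase_add (x y : Site d) (θ : Fin d → ℝ) : phase (x + y) θ = phase x θ + phase y θ := by
  simp [phase, add_mul, Finset.sum_add_distrib]

lemma phase_neg (x : Site d) (θ : Fin d → ℝ) : phase (-x) θ = -phase x θ := by
  simp [phase]

lemma phase_sub (x y : Site d) (θ : Fin d → ℝ) : phase (x - y) θ = phase x θ - phase y θ := by
  rw [sub_eq_add_neg, phase_add, phase_neg, sub_eq_add_neg]

lemma continuous_phase (x : Site d) : Continuous (phase x) := by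
  unfold phase; fun_prop

lemma IsJumpKernel.neg (hp : IsJumpKernel p) (z : Site d) : p 0 (-z) = p 0 z := by
  rw [hp.symm, hp.transl, zero_sub, neg_neg]

lemma IsJumpKernel.exists_finset (hp : IsJumpKernel p) :
    ∃ S : Finset (Site d), ∀ z, z ∉ S → p 0 z = 0 := by
  obtain ⟨R, -, h⟩ := hp.finite_range
  have hf : (Metric.closedBall (0 : Site d) R).Finite :=
    (isCompact_closedBall (0 : Site d) R).finite_of_discrete
  refine ⟨hf.toFinset, fun z hz => h 0 z ?_⟩
  simpa using hz

lemma IsJumpKernel.summable_cos (hp : IsJumpKernel p) (θ : Fin d → ℝ) :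
    Summable fun z => p 0 z * Real.cos (phase z θ) := by
  refine .of_norm_bounded (hp.sum_one 0).summable fun z => ?_
  rw [norm_mul, Real.norm_of_nonneg (hp.nonneg 0 z)]
  exact mul_le_of_le_one_right (hp.nonneg 0 z) (Real.abs_cos_le_one _)

lemma IsJumpKernel.summable_sin (hp : IsJumpKernel p) (θ : Fin d → ℝ) :
    Summable fun z => p 0 z * Real.sin (phase z θ) := by
  refine .of_norm_bounded (hp.sum_one 0).summable fun z => ?_
  rw [norm_mul, Real.norm_of_nonneg (hp.nonneg 0 z)]
  exact mul_le_of_le_one_right (hp.nonneg 0 z) (Real.abs_sin_le_one _)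

lemma IsJumpKernel.tsum_sin (hp : IsJumpKernel p) (θ : Fin d → ℝ) :
    ∑' z, p 0 z * Real.sin (phase z θ) = 0 := by
  have h : ∑' z, p 0 z * Real.sin (phase z θ) = -∑' z, p 0 z * Real.sin (phase z θ) := by
    conv_lhs => rw [← (Equiv.neg (Site d)).tsum_eq]
    simp [hp.neg, phase_neg, tsum_neg]
  linarith

/-- By symmetry of `p` the sine part cancels, so cosines are eigenfunctions of convolution with `p
0` and the whole Fourier analysis stays real. -/
lemma IsJumpKernel.tsum_cos_sub (hp : IsJumpKernel p) (a : ℝ) (θ : Fin d → ℝ) :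
    ∑' z, p 0 z * Real.cos (a - phase z θ) = jumpCharFun p θ * Real.cos a := by
  have h (z : Site d) : p 0 z * Real.cos (a - phase z θ)
      = p 0 z * Real.cos (phase z θ) * Real.cos a
        + p 0 z * Real.sin (phase z θ) * Real.sin a := by
    rw [Real.cos_sub]; ring
  simp_rw [h]
  rw [((hp.summable_cos θ).mul_right _).tsum_add ((hp.summable_sin θ).mul_right _),
    tsum_mul_right, tsum_mul_right, hp.tsum_sin, zero_mul, add_zero, jumpCharFun]

lemma IsJumpKernel.hasSum_one_sub (hp : IsJumpKernel p) (θ : Fin d → ℝ) :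
    HasSum (fun z => p 0 z * (1 - Real.cos (phase z θ))) (1 - jumpCharFun p θ) := by
  simpa [mul_sub, jumpCharFun] using (hp.sum_one 0).sub (hp.summable_cos θ).hasSum

lemma IsJumpKernel.abs_jumpCharFun_le (hp : IsJumpKernel p) (θ : Fin d → ℝ) :
    |jumpCharFun p θ| ≤ 1 := by
  have h := tsum_of_norm_bounded (f := fun z => p 0 z * Real.cos (phase z θ)) (hp.sum_one 0)
    fun z => by
      rw [norm_mul, Real.norm_of_nonneg (hp.nonneg 0 z)]
      exact mul_le_of_le_one_right (hp.nonneg 0 z) (Real.abs_cos_le_one _)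
  exact h

lemma IsJumpKernel.continuous_jumpCharFun (hp : IsJumpKernel p) :
    Continuous (jumpCharFun p) := by
  obtain ⟨S, hS⟩ := hp.exists_finset
  have : jumpCharFun p = fun θ => ∑ z ∈ S, p 0 z * Real.cos (phase z θ) := by
    ext θ
    exact tsum_eq_sum fun z hz => by rw [hS z hz, zero_mul]
  rw [this]
  exact continuous_finsetSum _ fun z _ =>
    continuous_const.mul (Real.continuous_cos.comp (continuous_phase z))

lemma IsJumpKernel.stepProb_transl (hp : IsJumpKernel p) (n : ℕ) (x y : Site d) :
    stepProb p n x y = stepProb p n 0 (y - x) := by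
  induction n generalizing x y with
  | zero => simp [stepProb, eq_comm, sub_eq_zero]
  | succ n ih =>
    simp only [stepProb]
    rw [← (Equiv.addRight x).tsum_eq]
    refine tsum_congr fun z => ?_
    rw [Equiv.coe_addRight, hp.transl, ih, ih z]
    rw [add_sub_cancel_right, sub_sub, add_comm x z]

lemma integral_exp_int_mul (m : ℤ) :
    ∫ θ in Set.Ioc (-Real.pi) Real.pi, Complex.exp ((m * θ : ℝ) * Complex.I)
      = if m = 0 then (2 * Real.pi : ℂ) else 0 := by
  rw [← intervalIntegral.integral_of_le (by linarith [Real.pi_pos])]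
  split_ifs with h
  · simp [h]; ring
  · have hc : (m * Complex.I : ℂ) ≠ 0 := by simp [h]
    have e : ∀ θ : ℝ, Complex.exp ((m * θ : ℝ) * Complex.I)
        = Complex.exp (m * Complex.I * θ) := fun θ => by push_cast; ring_nf
    simp_rw [e]
    rw [integral_exp_mul_complex hc]
    have : Complex.exp (m * Complex.I * (Real.pi : ℝ))
        = Complex.exp (m * Complex.I * ((-Real.pi : ℝ) : ℂ)) := by
      rw [Complex.exp_eq_exp_iff_exists_int]
      exact ⟨m, by push_cast; ring⟩
    rw [this, sub_self, zero_div]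

lemma integral_cos_phase (x : Site d) :
    ∫ θ, Real.cos (phase x θ) ∂torusMeasure d
      = if x = 0 then (2 * Real.pi) ^ d else 0 := by
  have h1 : ∫ θ, Complex.exp ((phase x θ : ℝ) * Complex.I) ∂torusMeasure d
      = ∏ j, if x j = 0 then (2 * Real.pi : ℂ) else 0 := by
    have e : ∀ θ : Fin d → ℝ, Complex.exp ((phase x θ : ℝ) * Complex.I)
        = ∏ j, Complex.exp ((x j * θ j : ℝ) * Complex.I) := fun θ => by
      rw [← Complex.exp_sum, phase]; push_cast; rw [Finset.sum_mul]
    simp_rw [e, torusMeasure]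
    rw [integral_fintype_prod_eq_prod
      (fun j (a : ℝ) => Complex.exp ((x j * a : ℝ) * Complex.I))]
    simp_rw [integral_exp_int_mul]
  have h2 : Integrable (fun θ => Complex.exp ((phase x θ : ℝ) * Complex.I)) (torusMeasure d) := by
    refine Integrable.of_bound (C := 1) ?_ (ae_of_all _ fun θ => ?_)
    · exact (Complex.continuous_exp.comp ((Complex.continuous_ofReal.comp
        (continuous_phase x)).mul continuous_const)).aestronglyMeasurable
    · rw [Complex.norm_exp_ofReal_mul_I]
  have h3 := congrArg Complex.re h1
  have h4 := integral_re (𝕜 := ℂ) h2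
  simp only [RCLike.re_eq_complex_re, Complex.exp_ofReal_mul_I_re] at h4
  rw [h4, h3]
  split_ifs with h
  · have : ((2 * Real.pi : ℂ) ^ d) = (((2 * Real.pi) ^ d : ℝ) : ℂ) := by push_cast; rfl
    simp only [h, Pi.zero_apply, if_true, Finset.prod_const, Finset.card_univ, Fintype.card_fin]
    rw [this, Complex.ofReal_re]
  · obtain ⟨j, hj⟩ := Function.ne_iff.1 h
    rw [Finset.prod_eq_zero (Finset.mem_univ j) (by simpa using hj), Complex.zero_re]

lemma IsJumpKernel.integrable_pow_mul_cos (hp : IsJumpKernel p) (n : ℕ) (x : Site d) :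
    Integrable (fun θ => jumpCharFun p θ ^ n * Real.cos (phase x θ)) (torusMeasure d) := by
  refine Integrable.of_bound (C := 1) ?_ (ae_of_all _ fun θ => ?_)
  · exact ((hp.continuous_jumpCharFun.pow n).mul
      (Real.continuous_cos.comp (continuous_phase x))).aestronglyMeasurable
  · rw [norm_mul, norm_pow]
    exact mul_le_one₀ (pow_le_one₀ (norm_nonneg _) (hp.abs_jumpCharFun_le θ)) (norm_nonneg _)
      (Real.abs_cos_le_one _)

lemma IsJumpKernel.stepProb_fourier (hp : IsJumpKernel p) (n : ℕ) (x : Site d) :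
    stepProb p n 0 x * (2 * Real.pi) ^ d
      = ∫ θ, jumpCharFun p θ ^ n * Real.cos (phase x θ) ∂torusMeasure d := by
  induction n generalizing x with
  | zero => simp [stepProb, integral_cos_phase, eq_comm]
  | succ n ih =>
    obtain ⟨S, hS⟩ := hp.exists_finset
    have e : stepProb p (n + 1) 0 x = ∑ z ∈ S, p 0 z * stepProb p n 0 (x - z) := by
      simp only [stepProb]
      rw [tsum_eq_sum (s := S) fun z hz => by rw [hS z hz, zero_mul]]
      exact Finset.sum_congr rfl fun z _ => by rw [hp.stepProb_transl]
    rw [e, Finset.sum_mul]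
    simp_rw [mul_assoc, ih, ← integral_const_mul]
    rw [← integral_finsetSum _ fun z _ => (hp.integrable_pow_mul_cos n (x - z)).const_mul _]
    congr 1
    ext θ
    have h := hp.tsum_cos_sub (phase x θ) θ
    rw [tsum_eq_sum (s := S) fun z hz => by rw [hS z hz, zero_mul]] at h
    rw [pow_succ, mul_assoc, ← h, Finset.mul_sum]
    refine Finset.sum_congr rfl fun z _ => ?_
    rw [phase_sub]; ring

/-- Poissonization of the step number turns the powers of `jumpCharFun p` into an exponential. Sum
and integral may be exchanged since the characteristic function is bounded by one, leaving the
summable Poisson weights. -/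
lemma IsJumpKernel.heatKernel_fourier (hp : IsJumpKernel p) {t : ℝ} (ht : 0 ≤ t) (x : Site d) :
    heatKernel p t 0 x * (2 * Real.pi) ^ d
      = ∫ θ, Real.exp (-(t * (1 - jumpCharFun p θ))) * Real.cos (phase x θ) ∂torusMeasure d := by
  set F : ℕ → (Fin d → ℝ) → ℝ := fun n θ =>
    Real.exp (-t) * t ^ n / (n.factorial : ℝ) * (jumpCharFun p θ ^ n * Real.cos (phase x θ))
  have hF (n : ℕ) : Integrable (F n) (torusMeasure d) :=
    (hp.integrable_pow_mul_cos n x).const_mul _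
  have hexp (a : ℝ) : HasSum (fun n : ℕ => Real.exp (-t) * a ^ n / (n.factorial : ℝ))
      (Real.exp (-t) * Real.exp a) := by
    have := (NormedSpace.expSeries_div_hasSum_exp (a : ℝ)).mul_left (Real.exp (-t))
    rw [← Real.exp_eq_exp_ℝ] at this
    simpa only [mul_div_assoc] using this
  have hs : Summable fun n => ∫ θ, ‖F n θ‖ ∂torusMeasure d := by
    refine Summable.of_nonneg_of_le (fun n => integral_nonneg fun θ => norm_nonneg _)
      (fun n => ?_) ((hexp t).summable.mul_right ((torusMeasure d).real Set.univ))
    calc ∫ θ, ‖F n θ‖ ∂torusMeasure d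
        ≤ ∫ _, Real.exp (-t) * t ^ n / (n.factorial : ℝ) ∂torusMeasure d := by
          refine integral_mono (hF n).norm (integrable_const _) fun θ => ?_
          have h0 : 0 ≤ Real.exp (-t) * t ^ n / (n.factorial : ℝ) := by positivity
          simp only [F]
          rw [norm_mul, Real.norm_of_nonneg h0]
          refine mul_le_of_le_one_right h0 ?_
          rw [norm_mul, norm_pow]
          exact mul_le_one₀ (pow_le_one₀ (norm_nonneg _) (hp.abs_jumpCharFun_le θ))
            (norm_nonneg _) (Real.abs_cos_le_one _)
      _ = _ := by rw [integral_const, smul_eq_mul, mul_comm]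
  have h1 := integral_tsum_of_summable_integral_norm hF hs
  have h2 : heatKernel p t 0 x * (2 * Real.pi) ^ d = ∑' n, ∫ θ, F n θ ∂torusMeasure d := by
    rw [heatKernel, ← tsum_mul_right]
    refine tsum_congr fun n => ?_
    rw [mul_assoc, hp.stepProb_fourier, ← integral_const_mul]
  rw [h2, h1]
  congr 1
  ext θ
  have h3 := (hexp (t * jumpCharFun p θ)).mul_right (Real.cos (phase x θ))
  rw [← Real.exp_add] at h3
  rw [show -(t * (1 - jumpCharFun p θ)) = -t + t * jumpCharFun p θ by ring, ← h3.tsum_eq]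
  refine tsum_congr fun n => ?_
  simp only [F, mul_pow]; ring

/-- Since $1-\cos x=2\sin^2(x/2)$, this is $(u+v)^2\le 2u^2+2v^2$. It serves as a triangle
inequality along lattice paths. -/
lemma one_sub_cos_add_le (a b : ℝ) :
    1 - Real.cos (a + b) ≤ 2 * (1 - Real.cos a) + 2 * (1 - Real.cos b) := by
  have h (x : ℝ) : 1 - Real.cos x = 2 * Real.sin (x / 2) ^ 2 := by
    have := Real.cos_sq' (x / 2)
    have h2 := Real.cos_two_mul (x / 2)
    rw [mul_div_cancel₀ _ (two_ne_zero)] at h2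
    linarith
  rw [h, h a, h b, add_div, Real.sin_add]
  have ha := Real.sin_sq_add_cos_sq (a / 2)
  have hb := Real.sin_sq_add_cos_sq (b / 2)
  have h1 : (Real.sin (a / 2) * Real.cos (b / 2)) ^ 2 ≤ Real.sin (a / 2) ^ 2 := by
    rw [mul_pow]; exact mul_le_of_le_one_right (sq_nonneg _)
      (by nlinarith [sq_nonneg (Real.sin (b / 2))])
  have h2 : (Real.cos (a / 2) * Real.sin (b / 2)) ^ 2 ≤ Real.sin (b / 2) ^ 2 := by
    rw [mul_pow]; exact mul_le_of_le_one_left (sq_nonneg _)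
      (by nlinarith [sq_nonneg (Real.sin (a / 2))])
  nlinarith [sq_nonneg (Real.sin (a / 2) * Real.cos (b / 2)
    - Real.cos (a / 2) * Real.sin (b / 2))]

/-- Irreducibility enters here. A jump of positive probability contributes one nonnegative term to
$1-\hat p=\sum_z p(0,z)(1-\cos(z\cdot\theta))$; the jumps are chained along a path from the origin
to `x`. -/
lemma IsJumpKernel.exists_one_sub_cos_le (hp : IsJumpKernel p) (x : Site d) :
    ∃ C : ℝ, 0 ≤ C ∧ ∀ θ, 1 - Real.cos (phase x θ) ≤ C * (1 - jumpCharFun p θ) := by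
  induction hp.irreducible 0 x with
  | refl => exact ⟨0, le_rfl, fun θ => by simp [phase_zero]⟩
  | @tail y z _ hyz ih =>
    obtain ⟨C, hC, h⟩ := ih
    rw [hp.transl] at hyz
    refine ⟨2 * C + 2 * (p 0 (z - y))⁻¹, by positivity, fun θ => ?_⟩
    have h1 : 1 - Real.cos (phase (z - y) θ) ≤ (p 0 (z - y))⁻¹ * (1 - jumpCharFun p θ) := by
      rw [inv_mul_eq_div, le_div_iff₀ hyz, mul_comm]
      exact le_hasSum (hp.hasSum_one_sub θ) _ fun w _ =>
        mul_nonneg (hp.nonneg 0 w) (sub_nonneg.2 (Real.cos_le_one _))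
    have h2 := one_sub_cos_add_le (phase y θ) (phase (z - y) θ)
    rw [← phase_add, add_sub_cancel] at h2
    have := h θ
    linarith

lemma IsJumpKernel.exists_coercive (hp : IsJumpKernel p) :
    ∃ κ : ℝ, 0 < κ ∧ ∀ θ : Fin d → ℝ, κ * ∑ j, (1 - Real.cos (θ j)) ≤ 1 - jumpCharFun p θ := by
  choose C hC h using fun j : Fin d => hp.exists_one_sub_cos_le (Pi.single j 1)
  -- The `C j` are only known to be nonnegative; the added one makes the sum invertible.
  have hpos : 0 < 1 + ∑ j, C j := by
    have := Finset.sum_nonneg fun j (_ : j ∈ Finset.univ) => hC j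
    linarith
  refine ⟨(1 + ∑ j, C j)⁻¹, inv_pos.2 hpos, fun θ => ?_⟩
  have hnn : 0 ≤ 1 - jumpCharFun p θ := sub_nonneg.2 (abs_le.1 (hp.abs_jumpCharFun_le θ)).2
  rw [inv_mul_le_iff₀ hpos, add_mul, one_mul, Finset.sum_mul]
  refine le_add_of_nonneg_of_le hnn (Finset.sum_le_sum fun j _ => ?_)
  have e : phase (Pi.single j 1) θ = θ j := by
    simp [phase, Pi.single_apply]
  simpa [e] using h j θ

/-- On $[-\pi,\pi]$ one has $1-\cos\theta\ge 2\theta^2/\pi^2$, so a full Gaussian integral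
dominates. -/
lemma setIntegral_exp_cos_le {a : ℝ} (ha : 0 < a) :
    ∫ θ in Set.Ioc (-Real.pi) Real.pi, Real.exp (-(a * (1 - Real.cos θ)))
      ≤ √(Real.pi ^ 3 / 2) / √a := by
  have hb : 0 < a * (2 / Real.pi ^ 2) := by positivity
  calc ∫ θ in Set.Ioc (-Real.pi) Real.pi, Real.exp (-(a * (1 - Real.cos θ)))
      ≤ ∫ θ in Set.Ioc (-Real.pi) Real.pi, Real.exp (-(a * (2 / Real.pi ^ 2)) * θ ^ 2) := by
        refine setIntegral_mono_on ?_ (integrable_exp_neg_mul_sq hb).integrableOn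
          measurableSet_Ioc fun θ hθ => ?_
        · exact ((by fun_prop : Continuous fun θ : ℝ =>
            Real.exp (-(a * (1 - Real.cos θ)))).integrableOn_Ioc)
        · have := Real.cos_le_one_sub_mul_cos_sq (abs_le.2 ⟨hθ.1.le, hθ.2⟩)
          rw [Real.exp_le_exp, neg_mul, neg_le_neg_iff, mul_assoc]
          exact mul_le_mul_of_nonneg_left (by linarith) ha.le
    _ ≤ ∫ θ, Real.exp (-(a * (2 / Real.pi ^ 2)) * θ ^ 2) :=
        setIntegral_le_integral (integrable_exp_neg_mul_sq hb) (ae_of_all _ fun _ => by positivity)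
    _ = √(Real.pi ^ 3 / 2) / √a := by
        rw [integral_gaussian, ← Real.sqrt_div (by positivity)]
        congr 1
        field_simp

/-- The on-diagonal bound `p_t(0,x) ≤ c t^{-d/2}`. -/
lemma IsJumpKernel.exists_heatKernel_le (hp : IsJumpKernel p) :
    ∃ c : ℝ, 0 < c ∧ ∀ t : ℝ, 0 < t → ∀ x, heatKernel p t 0 x ≤ c / √t ^ d := by
  obtain ⟨κ, hκ, h⟩ := hp.exists_coercive
  refine ⟨(√(Real.pi ^ 3 / 2) / √κ) ^ d / (2 * Real.pi) ^ d, by positivity, fun t ht x => ?_⟩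
  have hcont : Continuous fun θ : Fin d → ℝ => Real.exp (-(t * (1 - jumpCharFun p θ))) :=
    Real.continuous_exp.comp
      (continuous_const.mul (continuous_const.sub hp.continuous_jumpCharFun)).neg
  have hle1 (θ : Fin d → ℝ) : Real.exp (-(t * (1 - jumpCharFun p θ))) ≤ 1 := by
    rw [Real.exp_le_one_iff, neg_nonpos]
    exact mul_nonneg ht.le (sub_nonneg.2 (abs_le.1 (hp.abs_jumpCharFun_le θ)).2)
  have hint : Integrable (fun θ => Real.exp (-(t * (1 - jumpCharFun p θ)))) (torusMeasure d) :=
    Integrable.of_bound (C := 1) hcont.aestronglyMeasurable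
      (ae_of_all _ fun θ => by rw [Real.norm_of_nonneg (Real.exp_nonneg _)]; exact hle1 θ)
  have key : heatKernel p t 0 x * (2 * Real.pi) ^ d ≤ (√(Real.pi ^ 3 / 2) / √(t * κ)) ^ d := by
    rw [hp.heatKernel_fourier ht.le]
    calc ∫ θ, Real.exp (-(t * (1 - jumpCharFun p θ))) * Real.cos (phase x θ) ∂torusMeasure d
        ≤ ∫ θ, Real.exp (-(t * (1 - jumpCharFun p θ))) ∂torusMeasure d := by
          refine integral_mono ?_ hint fun θ =>
            mul_le_of_le_one_right (Real.exp_nonneg _) (Real.cos_le_one _)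
          refine hint.mono (hcont.mul (Real.continuous_cos.comp
            (continuous_phase x))).aestronglyMeasurable (ae_of_all _ fun θ => ?_)
          rw [norm_mul]
          exact mul_le_of_le_one_right (norm_nonneg _) (Real.abs_cos_le_one _)
      -- Coercivity replaces the characteristic function by a sum over coordinates, so the integral
      -- factors into one-dimensional ones.
      _ ≤ ∫ θ, ∏ j, Real.exp (-(t * κ * (1 - Real.cos (θ j)))) ∂torusMeasure d := by
          refine integral_mono hint ?_ fun θ => ?_
          · refine Integrable.of_bound (C := 1) ?_ (ae_of_all _ fun θ => ?_)
            · exact (by fun_prop : Continuous fun θ : Fin d → ℝ =>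
                ∏ j, Real.exp (-(t * κ * (1 - Real.cos (θ j))))).aestronglyMeasurable
            · rw [Real.norm_of_nonneg (Finset.prod_nonneg fun _ _ => Real.exp_nonneg _)]
              refine Finset.prod_le_one (fun _ _ => Real.exp_nonneg _) fun j _ => ?_
              rw [Real.exp_le_one_iff, neg_nonpos]
              exact mul_nonneg (by positivity) (sub_nonneg.2 (Real.cos_le_one _))
          · rw [← Real.exp_sum, Real.exp_le_exp, Finset.sum_neg_distrib, neg_le_neg_iff,
              ← Finset.mul_sum, mul_assoc]
            exact mul_le_mul_of_nonneg_left (h θ) ht.le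
      _ = (∫ θ in Set.Ioc (-Real.pi) Real.pi, Real.exp (-(t * κ * (1 - Real.cos θ)))) ^ d := by
          rw [torusMeasure, integral_fintype_prod_eq_prod
            (fun _ (a : ℝ) => Real.exp (-(t * κ * (1 - Real.cos a))))]
          simp
      _ ≤ _ := pow_le_pow_left₀ (integral_nonneg fun _ => Real.exp_nonneg _)
          (setIntegral_exp_cos_le (by positivity)) d
  rw [div_div, le_div_iff₀ (by positivity), ← mul_assoc]
  refine (mul_le_mul_of_nonneg_right key (by positivity)).trans (le_of_eq ?_)
  rw [← mul_pow, Real.sqrt_mul ht.le]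
  congr 1
  have := Real.sqrt_pos.2 ht
  have := Real.sqrt_pos.2 hκ
  field_simp

end HeatKernel

/-! ### Lattice sums of Schwartz functions -/

section LatticeSums

/-- The factor 2 comes from $N+m+1\le 2(N+m)$, valid since $N\ge1$; the right side is a telescoping
difference. -/
lemma inv_add_sq_le_telescope {N : ℝ} (hN : 1 ≤ N) (m : ℕ) :
    (1 + (m : ℝ) / N) ^ (-2 : ℤ)
      ≤ 2 * N ^ 2 * (1 / (N + m)) - 2 * N ^ 2 * (1 / (N + (m + 1 : ℕ))) := by
  have h0 : 0 < N := by linarith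
  have h1 : 0 < N + m := by positivity
  have h2 : 0 < N + m + 1 := by positivity
  have e : 2 * N ^ 2 * (1 / (N + m)) - 2 * N ^ 2 * (1 / (N + (m + 1 : ℕ)))
      = N ^ 2 * (2 / ((N + m) * (N + m + 1))) := by
    push_cast
    rw [← add_assoc]
    field_simp
    ring
  have e' : (1 + (m : ℝ) / N) ^ (-2 : ℤ) = N ^ 2 * (1 / (N + m) ^ 2) := by
    rw [zpow_neg, zpow_ofNat]
    field_simp
  rw [e, e']
  refine mul_le_mul_of_nonneg_left ?_ (by positivity)
  rw [div_le_div_iff₀ (by positivity) (by positivity)]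
  nlinarith [Nat.cast_nonneg (α := ℝ) m]

lemma sum_range_inv_add_sq_le {N : ℝ} (hN : 1 ≤ N) (n : ℕ) :
    ∑ m ∈ Finset.range n, (1 + (m : ℝ) / N) ^ (-2 : ℤ) ≤ 2 * N := by
  refine (Finset.sum_le_sum fun m _ => inv_add_sq_le_telescope hN m).trans ?_
  rw [Finset.sum_range_sub' (fun m : ℕ => 2 * N ^ 2 * (1 / (N + m)))]
  have h0 : 0 < N := by linarith
  have : 2 * N ^ 2 * (1 / (N + (0 : ℕ))) = 2 * N := by
    rw [Nat.cast_zero, add_zero]; field_simp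
  rw [this]
  exact sub_le_self _ (by positivity)

lemma sum_int_inv_add_sq_le {N : ℝ} (hN : 1 ≤ N) (s : Finset ℤ) :
    ∑ m ∈ s, (1 + |(m : ℝ)| / N) ^ (-2 : ℤ) ≤ 4 * N := by
  have h0 : 0 < N := by linarith
  have hnn (a : ℝ) (ha : 0 ≤ a) : 0 ≤ (1 + a / N) ^ (-2 : ℤ) := by positivity
  have hs : Summable fun m : ℕ => (1 + (m : ℝ) / N) ^ (-2 : ℤ) :=
    summable_of_sum_range_le (fun m => hnn _ (Nat.cast_nonneg m)) (sum_range_inv_add_sq_le hN)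
  have hs' := (summable_nat_add_iff 1).2 hs
  have ht : ∑' m : ℕ, (1 + (m : ℝ) / N) ^ (-2 : ℤ) ≤ 2 * N :=
    hs.tsum_le_of_sum_range_le (sum_range_inv_add_sq_le hN)
  have ht' : ∑' m : ℕ, (1 + ((m + 1 : ℕ) : ℝ) / N) ^ (-2 : ℤ) ≤ 2 * N := by
    have := hs.sum_add_tsum_nat_add 1
    have h1 := Finset.sum_nonneg fun m (_ : m ∈ Finset.range 1) => hnn (m : ℝ) (Nat.cast_nonneg m)
    linarith
  have key : HasSum (fun m : ℤ => (1 + |(m : ℝ)| / N) ^ (-2 : ℤ))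
      (∑' m : ℕ, (1 + (m : ℝ) / N) ^ (-2 : ℤ)
        + ∑' m : ℕ, (1 + ((m + 1 : ℕ) : ℝ) / N) ^ (-2 : ℤ)) := by
    refine HasSum.of_nat_of_neg_add_one ?_ ?_
    · simpa using hs.hasSum
    · refine hs'.hasSum.congr_fun fun m => ?_
      congr 3
      push_cast
      rw [abs_of_nonpos (by linarith [Nat.cast_nonneg (α := ℝ) m])]
      ring
  have := sum_le_hasSum s (fun m _ => hnn _ (abs_nonneg _)) key
  linarith

lemma sum_prod_le {d : ℕ} {g : ℤ → ℝ} (hg : ∀ m, 0 ≤ g m) {B : ℝ}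
    (hB : ∀ s : Finset ℤ, ∑ m ∈ s, g m ≤ B) (s : Finset (Site d)) :
    ∑ x ∈ s, ∏ j, g (x j) ≤ B ^ d := by
  classical
  calc ∑ x ∈ s, ∏ j, g (x j)
      ≤ ∑ x ∈ Fintype.piFinset fun j => s.image fun x => x j, ∏ j, g (x j) := by
        refine Finset.sum_le_sum_of_subset_of_nonneg (fun x hx => ?_)
          fun x _ _ => Finset.prod_nonneg fun j _ => hg _
        exact Fintype.mem_piFinset.2 fun j => Finset.mem_image_of_mem (fun x => x j) hx
    _ = ∏ j, ∑ m ∈ s.image fun x => x j, g m := by rw [Finset.prod_univ_sum]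
    _ ≤ ∏ _j : Fin d, B := Finset.prod_le_prod (fun j _ => Finset.sum_nonneg fun m _ => hg m)
        fun j _ => hB _
    _ = B ^ d := by simp

/-- Decay of order `2 * d` in the norm controls a product of quadratic decays in the coordinates; in
product form, lattice sums reduce to dimension one. -/
lemma exists_abs_schwartz_le {d : ℕ} (φ : 𝓢(EuclideanSpace ℝ (Fin d), ℝ)) :
    ∃ C : ℝ, 0 ≤ C ∧ ∀ u, |φ u| ≤ C * ∏ j, (1 + |u j|) ^ (-2 : ℤ) := by
  set C : ℝ := 2 ^ (2 * d)
    * ((Finset.Iic (2 * d, 0)).sup fun m => SchwartzMap.seminorm ℝ m.1 m.2) φ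
  have h (u : EuclideanSpace ℝ (Fin d)) : (1 + ‖u‖) ^ (2 * d) * |φ u| ≤ C := by
    have := SchwartzMap.one_add_le_sup_seminorm_apply (𝕜 := ℝ) (m := (2 * d, 0))
      (k := 2 * d) (n := 0) le_rfl le_rfl φ u
    rwa [norm_iteratedFDeriv_zero] at this
  refine ⟨C, le_trans (by positivity) (h 0), fun u => ?_⟩
  have hpos : 0 < ∏ j, (1 + |u j|) ^ 2 := Finset.prod_pos fun j _ => by positivity
  have hle : ∏ j, (1 + |u j|) ^ 2 ≤ (1 + ‖u‖) ^ (2 * d) := by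
    calc ∏ j, (1 + |u j|) ^ 2 ≤ ∏ _j : Fin d, (1 + ‖u‖) ^ 2 := by
          refine Finset.prod_le_prod (fun j _ => by positivity) fun j _ => ?_
          have : |u j| ≤ ‖u‖ := PiLp.norm_apply_le u j
          gcongr
      _ = _ := by simp [pow_mul]
  have e : ∏ j, (1 + |u j|) ^ (-2 : ℤ) = (∏ j, (1 + |u j|) ^ 2)⁻¹ := by
    rw [← Finset.prod_inv_distrib]
    exact Finset.prod_congr rfl fun j _ => by rw [zpow_neg, zpow_ofNat]
  rw [e, ← div_eq_mul_inv, le_div_iff₀ hpos, mul_comm]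
  exact (mul_le_mul_of_nonneg_right hle (abs_nonneg _)).trans (h u)

/-- Riemann sums of a Schwartz function are absolutely convergent and of order `N ^ d`. -/
lemma exists_lattice_sum_le {d : ℕ} (φ : 𝓢(EuclideanSpace ℝ (Fin d), ℝ)) :
    ∃ S : ℝ, 0 ≤ S ∧ ∀ N : ℕ, 1 ≤ N → (Summable fun x : Site d => |φ (scaledPoint N x)|) ∧
      ∑' x : Site d, |φ (scaledPoint N x)| ≤ S * (N : ℝ) ^ d := by
  obtain ⟨C, hC, h⟩ := exists_abs_schwartz_le φ
  refine ⟨C * 4 ^ d, by positivity, fun N hN => ?_⟩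
  have hN' : (1 : ℝ) ≤ N := by exact_mod_cast hN
  have hsum (s : Finset (Site d)) :
      ∑ x ∈ s, |φ (scaledPoint N x)| ≤ C * 4 ^ d * (N : ℝ) ^ d := by
    calc ∑ x ∈ s, |φ (scaledPoint N x)|
        ≤ ∑ x ∈ s, C * ∏ j, (1 + |(x j : ℝ)| / N) ^ (-2 : ℤ) := by
          refine Finset.sum_le_sum fun x _ => (h _).trans_eq ?_
          simp [scaledPoint, abs_div]
      _ = C * ∑ x ∈ s, ∏ j, (1 + |(x j : ℝ)| / N) ^ (-2 : ℤ) := by rw [Finset.mul_sum]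
      _ ≤ C * (4 * (N : ℝ)) ^ d := mul_le_mul_of_nonneg_left
          (sum_prod_le (g := fun m => (1 + |(m : ℝ)| / N) ^ (-2 : ℤ)) (fun m => by positivity)
            (sum_int_inv_add_sq_le hN') s) hC
      _ = _ := by rw [mul_pow, mul_assoc]
  exact ⟨summable_of_sum_le (fun _ => abs_nonneg _) hsum,
    Real.tsum_le_of_sum_le (fun _ => abs_nonneg _) hsum⟩

lemma exists_abs_schwartz_le_const {d : ℕ} (φ : 𝓢(EuclideanSpace ℝ (Fin d), ℝ)) :
    ∃ M : ℝ, 0 ≤ M ∧ ∀ u, |φ u| ≤ M := by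
  obtain ⟨C, hC, h⟩ := exists_abs_schwartz_le φ
  refine ⟨C, hC, fun u => (h u).trans (mul_le_of_le_one_right hC ?_)⟩
  refine Finset.prod_le_one (fun j _ => by positivity) fun j _ => ?_
  rw [zpow_neg, zpow_ofNat]
  exact inv_le_one_of_one_le₀ (one_le_pow₀ (by linarith [abs_nonneg (u j)]))

end LatticeSums

/-! ### Poisson moments -/

section PoissonMoments

/-- The second Charlier polynomial as a function on `ℝ`. -/
def charlierTwo (r x : ℝ) : ℝ := x * (x - 1) - 2 * r * (x - r) - r ^ 2

lemma continuous_charlierTwo (r : ℝ) : Continuous (charlierTwo r) := by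
  unfold charlierTwo; fun_prop

/-- The first `k` terms vanish, and shifting the index by `k` reproduces the Poisson weights times
$a^k$. Polynomial moments are computed below by expansion in descending factorials. -/
lemma hasSum_poisson_descFactorial (a : ℝ≥0) (k : ℕ) :
    HasSum (fun n : ℕ => Real.exp (-a) * (a : ℝ) ^ n / (n.factorial : ℝ) * (n.descFactorial k : ℝ))
      ((a : ℝ) ^ k) := by
  have h0 : ∑ n ∈ Finset.range k, Real.exp (-a) * (a : ℝ) ^ n / (n.factorial : ℝ)
      * (n.descFactorial k : ℝ) = 0 :=
    Finset.sum_eq_zero fun n hn => by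
      rw [Nat.descFactorial_eq_zero_iff_lt.2 (Finset.mem_range.1 hn), Nat.cast_zero, mul_zero]
  rw [← hasSum_nat_add_iff' k, h0, sub_zero]
  have h := (hasSum_one_poissonMeasure a).mul_right ((a : ℝ) ^ k)
  rw [one_mul] at h
  refine h.congr_fun fun n => ?_
  have e : ((n + k).factorial : ℝ) = n.factorial * (n + k).descFactorial k := by
    have := Nat.factorial_mul_descFactorial (Nat.le_add_left k n)
    rw [Nat.add_sub_cancel] at this
    exact_mod_cast this.symm
  have hd : ((n + k).descFactorial k : ℝ) ≠ 0 := by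
    exact_mod_cast Nat.descFactorial_eq_zero_iff_lt.not.2 (by omega)
  have hf : (n.factorial : ℝ) ≠ 0 := by exact_mod_cast n.factorial_ne_zero
  rw [e, pow_add]
  field_simp

lemma integrable_descFactorial (a : ℝ≥0) (k : ℕ) :
    Integrable (fun n : ℕ => (n.descFactorial k : ℝ)) (poissonMeasure a) := by
  rw [integrable_poissonMeasure_iff]
  simpa using (hasSum_poisson_descFactorial a k).summable

lemma integral_descFactorial (a : ℝ≥0) (k : ℕ) :
    ∫ n, (n.descFactorial k : ℝ) ∂poissonMeasure a = (a : ℝ) ^ k := by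
  rw [integral_poissonMeasure]
  simpa using (hasSum_poisson_descFactorial a k).tsum_eq

lemma cast_descFactorial_two (n : ℕ) : (n.descFactorial 2 : ℝ) = n * (n - 1) := by
  rcases n with _ | n <;> simp [Nat.descFactorial]; ring

lemma cast_descFactorial_succ (n k : ℕ) :
    (n.descFactorial (k + 1) : ℝ) = (n - k) * n.descFactorial k := by
  rw [Nat.descFactorial_succ]
  rcases le_or_gt k n with h | h
  · push_cast [Nat.cast_sub h]; rfl
  · rw [Nat.descFactorial_eq_zero_iff_lt.2 h]; simp

lemma charlierTwo_sq_eq (a : ℝ) (n : ℕ) :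
    charlierTwo a n ^ 2 = n.descFactorial 4 + (4 - 4 * a) * n.descFactorial 3
      + (2 - 8 * a + 6 * a ^ 2) * n.descFactorial 2
      + (4 * a ^ 2 - 4 * a ^ 3) * n.descFactorial 1 + a ^ 4 * n.descFactorial 0 := by
  simp only [cast_descFactorial_succ, Nat.descFactorial_zero, charlierTwo]
  push_cast
  ring

lemma integrable_charlierTwo_sq (a : ℝ≥0) (r : ℝ) :
    Integrable (fun n : ℕ => charlierTwo r n ^ 2) (poissonMeasure a) := by
  simp_rw [charlierTwo_sq_eq]
  exact (((((integrable_descFactorial a 4).add ((integrable_descFactorial a 3).const_mul _)).add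
    ((integrable_descFactorial a 2).const_mul _)).add
    ((integrable_descFactorial a 1).const_mul _)).add
    ((integrable_descFactorial a 0).const_mul _))

lemma integral_charlierTwo_sq (a : ℝ≥0) :
    ∫ n : ℕ, charlierTwo a n ^ 2 ∂poissonMeasure a = 2 * (a : ℝ) ^ 2 := by
  simp_rw [charlierTwo_sq_eq]
  have h (k : ℕ) (c : ℝ) := (integrable_descFactorial a k).const_mul c
  rw [integral_add ((((integrable_descFactorial a 4).fun_add (h 3 _)).fun_add (h 2 _)).fun_add (h 1 _)) (h 0 _),
    integral_add (((integrable_descFactorial a 4).fun_add (h 3 _)).fun_add (h 2 _)) (h 1 _),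
    integral_add ((integrable_descFactorial a 4).fun_add (h 3 _)) (h 2 _),
    integral_add (integrable_descFactorial a 4) (h 3 _)]
  simp_rw [integral_const_mul, integral_descFactorial]
  ring

/-- Averaging out a Poisson part of a configuration turns the Charlier polynomial of the total
density into the one of the remaining density. -/
lemma integral_charlierTwo_add (r : ℝ) (b : ℝ≥0) (x : ℝ) :
    ∫ n : ℕ, charlierTwo r (x + n) ∂poissonMeasure b = charlierTwo (r - b) x := by
  have e (n : ℕ) : charlierTwo r (x + n) = n.descFactorial 2 + (2 * x - 2 * r) * n.descFactorial 1
      + (x * (x - 1) - 2 * r * (x - r) - r ^ 2) * n.descFactorial 0 := by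
    simp only [cast_descFactorial_succ, Nat.descFactorial_zero, charlierTwo]
    push_cast
    ring
  have h (k : ℕ) (c : ℝ) := (integrable_descFactorial b k).const_mul c
  simp_rw [e]
  rw [integral_add ((integrable_descFactorial b 2).fun_add (h 1 _)) (h 0 _),
    integral_add (integrable_descFactorial b 2) (h 1 _)]
  simp_rw [integral_const_mul, integral_descFactorial]
  unfold charlierTwo
  ring

lemma integral_pow_poissonMeasure (a : ℝ≥0) (z : ℂ) :
    ∫ n : ℕ, z ^ n ∂poissonMeasure a = Complex.exp (a * (z - 1)) := by
  rw [integral_poissonMeasure]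
  have h := ((NormedSpace.expSeries_div_hasSum_exp ((a : ℂ) * z)).mul_left
    (Complex.exp (-a))).tsum_eq
  rw [← Complex.exp_eq_exp_ℂ, ← Complex.exp_add] at h
  rw [show (a : ℂ) * (z - 1) = -a + a * z by ring, ← h]
  refine tsum_congr fun n => ?_
  rw [Complex.real_smul]
  push_cast
  rw [mul_pow]
  ring

/-- The covariance of the second Charlier polynomials of `A + B` and `A + C`, for independent
Poisson variables of means `a`, `b`, `b`. -/
lemma integral_charlierTwo_mul (a b : ℝ≥0)
    (h : Integrable (fun q : ℕ × ℕ × ℕ => charlierTwo (a + b) (q.1 + q.2.1)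
      * charlierTwo (a + b) (q.1 + q.2.2))
      ((poissonMeasure a).prod ((poissonMeasure b).prod (poissonMeasure b)))) :
    ∫ q : ℕ × ℕ × ℕ, charlierTwo (a + b) (q.1 + q.2.1) * charlierTwo (a + b) (q.1 + q.2.2)
      ∂(poissonMeasure a).prod ((poissonMeasure b).prod (poissonMeasure b)) = 2 * (a : ℝ) ^ 2 := by
  -- For a fixed value of the common part the two factors are independent, and each averages to
  -- `charlierTwo a`; what remains is the variance for the common part.
  rw [integral_prod _ h, ← integral_charlierTwo_sq]
  congr 1
  ext n
  simp only
  rw [integral_prod_mul (fun m : ℕ => charlierTwo (a + b) (n + m))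
    (fun m : ℕ => charlierTwo (a + b) (n + m)), integral_charlierTwo_add, add_sub_cancel_right, sq]

end PoissonMoments

/-! ### Marked Poisson configurations -/

section MarkedPoisson

variable {d : ℕ} {Ω : Type*} [MeasurableSpace Ω] {P : Measure Ω}

lemma integral_prod_pow_poissonProduct (ρ : ℝ≥0) (F : Finset (Site d)) (m : Site d → ℂ) :
    ∫ η : Config d, ∏ z ∈ F, m z ^ η z ∂poissonProduct d ρ
      = ∏ z ∈ F, Complex.exp (ρ * (m z - 1)) := by
  have h : (poissonProduct d ρ).map F.restrict = Measure.pi fun _ : F => poissonMeasure ρ :=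
    Measure.infinitePi_map_restrict _
  have e (η : Config d) : ∏ z ∈ F, m z ^ η z
      = (fun ξ : F → ℕ => ∏ z : F, m z ^ ξ z) (F.restrict η) := by
    simp only [Finset.restrict]
    exact (Finset.prod_coe_sort F fun z => m z ^ η z).symm
  have h2 := integral_map (μ := poissonProduct d ρ) (φ := F.restrict)
    (f := fun ξ : F → ℕ => ∏ z : F, m z ^ ξ z) (Finset.measurable_restrict F).aemeasurable
    (Measurable.of_discrete).aestronglyMeasurable
  refine (integral_congr_ae (ae_of_all _ e)).trans (h2.symm.trans ?_)
  rw [h, integral_fintype_prod_eq_prod (fun (z : F) (n : ℕ) => m z ^ n)]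
  simp_rw [integral_pow_poissonMeasure]
  exact Finset.prod_coe_sort F fun z => Complex.exp (ρ * (m z - 1))

lemma measurable_prod_marks {E : Type*} [MeasurableSpace E] {f : Site d → E → ℂ}
    (hf : ∀ z, Measurable (f z)) (F : Finset (Site d)) :
    Measurable fun q : Config d × (Site d × ℕ → E) =>
      ∏ z ∈ F, ∏ k ∈ Finset.range (q.1 z), f z (q.2 (z, k)) := by
  refine Finset.measurable_fun_prod _ fun z _ => ?_
  have h1 : Measurable fun q : ℕ × (Site d × ℕ → E) =>
      ∏ k ∈ Finset.range q.1, f z (q.2 (z, k)) := by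
    refine measurable_from_prod_countable_right fun n => ?_
    have h0 (k : ℕ) : Measurable fun v : Site d × ℕ → E => f z (v (z, k)) :=
      (hf z).comp (measurable_pi_apply (z, k))
    exact Finset.measurable_fun_prod (Finset.range n) fun k _ => h0 k
  have h2 : Measurable fun q : Config d × (Site d × ℕ → E) => (q.1 z, q.2) :=
    ((measurable_pi_apply z).comp measurable_fst).prodMk measurable_snd
  exact h1.comp h2

lemma norm_prod_marks_le {E : Type*} {f : Site d → E → ℂ} (hf1 : ∀ z e, ‖f z e‖ ≤ 1)
    (F : Finset (Site d)) (q : Config d × (Site d × ℕ → E)) :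
    ‖∏ z ∈ F, ∏ k ∈ Finset.range (q.1 z), f z (q.2 (z, k))‖ ≤ 1 := by
  simp only [norm_prod]
  exact Finset.prod_le_one (fun _ _ => Finset.prod_nonneg fun _ _ => norm_nonneg _)
    fun z _ => Finset.prod_le_one (fun _ _ => norm_nonneg _) fun k _ => hf1 z _

/-- The generating function of a finite part of a marked Poisson configuration. -/
lemma integral_prod_marks [IsProbabilityMeasure P] {E : Type*} [MeasurableSpace E] {ρ : ℝ≥0} {η₀ : Ω → Config d}
    (hη : Measurable η₀) (hlaw : P.map η₀ = poissonProduct d ρ) {V : Site d × ℕ → Ω → E}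
    (hV : ∀ i, Measurable (V i)) (hind : iIndepFun V P)
    (hind' : IndepFun η₀ (fun ω i => V i ω) P) {f : Site d → E → ℂ}
    (hf : ∀ z, Measurable (f z)) (hf1 : ∀ z e, ‖f z e‖ ≤ 1) {m : Site d → ℂ}
    (hm : ∀ z k, ∫ ω, f z (V (z, k) ω) ∂P = m z) (F : Finset (Site d)) :
    ∫ ω, ∏ z ∈ F, ∏ k ∈ Finset.range (η₀ ω z), f z (V (z, k) ω) ∂P
      = ∏ z ∈ F, Complex.exp (ρ * (m z - 1)) := by
  have hVm : Measurable fun ω i => V i ω := measurable_pi_lambda _ hV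
  set g : Config d × (Site d × ℕ → E) → ℂ := fun q =>
    ∏ z ∈ F, ∏ k ∈ Finset.range (q.1 z), f z (q.2 (z, k))
  have hgm : Measurable g := measurable_prod_marks hf F
  have hg1 (q) : ‖g q‖ ≤ 1 := norm_prod_marks_le hf1 F q
  have hmap := (indepFun_iff_map_prod_eq_prod_map_map hη.aemeasurable hVm.aemeasurable).1 hind'
  have : IsProbabilityMeasure (P.map η₀) := Measure.isProbabilityMeasure_map hη.aemeasurable
  have : IsProbabilityMeasure (P.map fun ω i => V i ω) :=
    Measure.isProbabilityMeasure_map hVm.aemeasurable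
  calc ∫ ω, g (η₀ ω, fun i => V i ω) ∂P
      = ∫ q, g q ∂P.map fun ω => (η₀ ω, fun i => V i ω) :=
        (integral_map (hη.prodMk hVm).aemeasurable hgm.aestronglyMeasurable).symm
    _ = ∫ η, ∫ v, g (η, v) ∂(P.map fun ω i => V i ω) ∂P.map η₀ := by
        rw [hmap]
        exact integral_prod _ (Integrable.of_bound hgm.aestronglyMeasurable 1 (ae_of_all _ hg1))
    _ = ∫ η, ∏ z ∈ F, m z ^ η z ∂P.map η₀ := by
        congr 1
        ext η
        have hgη : Measurable fun v => g (η, v) := hgm.comp measurable_prodMk_left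
        rw [integral_map hVm.aemeasurable hgη.aestronglyMeasurable]
        -- With the initial configuration frozen, only the finitely many labels in `G` occur, and
        -- independence of their marks gives a factor `m z` per particle.
        set G : Finset (Σ _ : Site d, ℕ) := F.sigma fun z => Finset.range (η z)
        have hG := hind.precomp (g := fun x : G => (x.1.1, x.1.2)) (by
          rintro ⟨⟨a, b⟩, _⟩ ⟨⟨a', b'⟩, _⟩ h
          simp only [Prod.mk.injEq] at h
          obtain ⟨rfl, rfl⟩ := h
          rfl)
        have h2 := hG.integral_fun_prod_comp (f := fun x : G => f x.1.1)
          (fun x => (hV _).aemeasurable) (fun x => (hf _).aestronglyMeasurable)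
        simp only [hm] at h2
        rw [Finset.prod_coe_sort G fun x => m x.1, Finset.prod_sigma] at h2
        simp only [Finset.prod_const, Finset.card_range] at h2
        rw [← h2]
        congr 1
        ext ω
        rw [Finset.prod_coe_sort G fun x => f x.1 (V (x.1, x.2) ω), Finset.prod_sigma]
    _ = _ := by rw [hlaw, integral_prod_pow_poissonProduct]

lemma tsum_measure_lt {ρ : ℝ≥0} {η₀ : Ω → Config d}
    (hη : Measurable η₀) (hlaw : P.map η₀ = poissonProduct d ρ) (z : Site d) :
    ∑' k : ℕ, P {ω | k < η₀ ω z} = ρ := by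
  have hz : Measurable fun ω => η₀ ω z := (measurable_pi_apply z).comp hη
  have hlz : P.map (fun ω => η₀ ω z) = poissonMeasure ρ := by
    rw [← Function.comp_def (fun η : Config d => η z) η₀,
      ← Measure.map_map (measurable_pi_apply z) hη, hlaw]
    exact (measurePreserving_eval_infinitePi _ z).map_eq
  have e1 (k : ℕ) : P {ω | k < η₀ ω z}
      = ∫⁻ n, (Set.Ioi k).indicator (fun _ => 1) n ∂poissonMeasure ρ := by
    rw [lintegral_indicator_const measurableSet_Ioi, one_mul, ← hlz,
      Measure.map_apply hz measurableSet_Ioi]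
    rfl
  simp_rw [e1]
  rw [← lintegral_tsum fun k => (Measurable.of_discrete).aemeasurable]
  have e2 (n : ℕ) : ∑' k : ℕ, (Set.Ioi k).indicator (fun _ => (1 : ENNReal)) n
      = ENNReal.ofReal (n.descFactorial 1) := by
    rw [tsum_eq_sum (s := Finset.range n) fun k hk => by
      rw [Set.indicator_of_notMem]; simpa using hk]
    rw [Finset.sum_congr rfl fun k hk => Set.indicator_of_mem
      (show n ∈ Set.Ioi k from Finset.mem_range.1 hk) _]
    simp
  simp_rw [e2]
  rw [← ofReal_integral_eq_lintegral_ofReal (integrable_descFactorial ρ 1)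
    (ae_of_all _ fun n => Nat.cast_nonneg _), integral_descFactorial, pow_one,
    ENNReal.ofReal_coe_nnreal]

/-- The count is an `ENNReal`-valued sum of indicators. Its `toReal` sends infinity to 0, which
matches the value of `Set.ncard` on infinite sets. -/
lemma measurable_ncard_setOf {α ι : Type*} [MeasurableSpace α] [Countable ι] {s : ι → Set α}
    (hs : ∀ i, MeasurableSet (s i)) : Measurable fun a => Set.ncard {i | a ∈ s i} := by
  let _ : MeasurableSpace ι := ⊤
  have h : Measurable fun a => ∑' i, (s i).indicator (fun _ => (1 : ENNReal)) a :=
    Measurable.tsum fun i => measurable_const.indicator (hs i)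
  have e (a : α) : ((Set.ncard {i | a ∈ s i} : ℕ) : ℝ)
      = (∑' i, (s i).indicator (fun _ => (1 : ENNReal)) a).toReal := by
    have : ∑' i, (s i).indicator (fun _ => (1 : ENNReal)) a = Measure.count {i | a ∈ s i} := by
      rw [← lintegral_indicator_one (by trivial), lintegral_count]
      rfl
    rw [this, Measure.count_apply (by trivial), Set.ncard_def]
    generalize Set.encard {i | a ∈ s i} = n
    induction n using ENat.recTopCoe <;> simp
  refine (MeasurableEmbedding.natCast (α := ℝ)).measurable_comp_iff.1 ?_
  rw [Function.comp_def]
  simp_rw [e]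
  exact h.ennreal_toReal

end MarkedPoisson

/-! ### The occupation numbers -/

section Occupation

variable {d : ℕ} {Ω : Type*} [MeasurableSpace Ω] {P : Measure Ω}
  {p : Site d → Site d → ℝ} {ρ : ℝ≥0} {η₀ : Ω → Config d}
  {W : Site d × ℕ → ℝ≥0 → Ω → Site d}

/-- Joint measurability follows by evaluating the path at grid points strictly to the right of `t`,
namely `(⌊t(n+1)⌋ + 1)/(n+1)`, and using right continuity. -/
lemma IsContinuousTimeWalk.measurable_uncurry {X : ℝ≥0 → Ω → Site d}
    (h : IsContinuousTimeWalk P p X) : Measurable fun q : ℝ≥0 × Ω => X q.1 q.2 := by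
  obtain ⟨c, hcm, hc1, hc2⟩ : ∃ c : ℕ → ℝ≥0 → ℕ, (∀ n, Measurable (c n)) ∧
      (∀ n t, t * (n + 1) < c n t + 1) ∧ ∀ n t, (c n t : ℝ≥0) ≤ t * (n + 1) :=
    ⟨fun n t => ⌊t * (n + 1)⌋₊, fun n => Nat.measurable_floor.comp (measurable_id.mul_const _),
      fun n t => Nat.lt_floor_add_one _, fun n t => Nat.floor_le (by positivity)⟩
  have h1 (t : ℝ≥0) (n : ℕ) : t < (c n t + 1) / (n + 1) := by
    rw [lt_div_iff₀ (by positivity)]; exact hc1 n t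
  have h2 (t : ℝ≥0) (n : ℕ) : ((c n t : ℝ≥0) + 1) / (n + 1) ≤ t + 1 / (n + 1) := by
    have : (0 : ℝ≥0) < n + 1 := by positivity
    rw [div_le_iff₀ this, add_mul, one_div_mul_cancel this.ne']
    gcongr
    exact hc2 n t
  have hlim (t : ℝ≥0) :
      Tendsto (fun n : ℕ => ((c n t : ℝ≥0) + 1) / (n + 1)) atTop (𝓝[>] t) := by
    refine tendsto_nhdsWithin_iff.2 ⟨?_, Eventually.of_forall fun n => h1 t n⟩
    refine tendsto_of_tendsto_of_tendsto_of_le_of_le tendsto_const_nhds ?_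
      (fun n => (h1 t n).le) (fun n => h2 t n)
    simpa using tendsto_const_nhds.add (tendsto_one_div_add_atTop_nhds_zero_nat (𝕜 := ℝ≥0))
  refine measurable_of_tendsto_metrizable
    (f := fun (n : ℕ) (q : ℝ≥0 × Ω) => X ((c n q.1 + 1) / (n + 1)) q.2)
    (fun n => ?_) (tendsto_pi_nhds.2 fun q => ?_)
  · obtain ⟨r, hr⟩ : ∃ r : ℕ → ℝ≥0, ∀ k, r k = ((k : ℝ≥0) + 1) / (n + 1) := ⟨_, fun _ => rfl⟩
    simp_rw [← hr]
    have h3 : Measurable fun q : ℕ × Ω => X (r q.1) q.2 :=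
      measurable_from_prod_countable_right fun k => h.measurable (r k)
    have h4 : Measurable fun q : ℝ≥0 × Ω => (c n q.1, q.2) :=
      ((hcm n).comp measurable_fst).prodMk measurable_snd
    exact h3.comp h4
  · have := (hlim q.1).eventually (h.right_cont q.2 q.1)
    exact tendsto_const_nhds.congr' (this.mono fun n hn => hn.symm)

lemma IsContinuousTimeWalk.measureReal_eq {X : ℝ≥0 → Ω → Site d}
    (h : IsContinuousTimeWalk P p X) (t : ℝ≥0) (x : Site d) :
    P.real {ω | X t ω = x} = heatKernel p t 0 x := by
  have := h.increment_law 0 t zero_le x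
  simpa [h.start] using this

lemma hasSum_measureReal_eq [IsProbabilityMeasure P] {X : Ω → Site d} (hX : Measurable X) :
    HasSum (fun x => P.real {ω | X ω = x}) 1 := by
  have h := tsum_measure_preimage_singleton (μ := P) (f := X) (s := Set.univ) Set.countable_univ
    fun y _ => hX (measurableSet_singleton y)
  rw [Set.preimage_univ, measure_univ, tsum_univ fun y => P (X ⁻¹' {y})] at h
  have h3 := (ENNReal.hasSum_toReal (f := fun y => P (X ⁻¹' {y})) (by rw [h]; simp))
  rw [← ENNReal.tsum_toReal_eq fun y => measure_ne_top _ _, h] at h3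
  exact h3

lemma IsContinuousTimeWalk.hasSum_heatKernel [IsProbabilityMeasure P] {X : ℝ≥0 → Ω → Site d}
    (h : IsContinuousTimeWalk P p X) (t : ℝ≥0) : HasSum (fun x => heatKernel p t 0 x) 1 :=
  (hasSum_measureReal_eq (h.measurable t)).congr_fun fun x => (h.measureReal_eq t x).symm

lemma IsContinuousTimeWalk.measureReal_eq_and {X : ℝ≥0 → Ω → Site d}
    (h : IsContinuousTimeWalk P p X) {s t : ℝ≥0} (hst : s ≤ t) (x y : Site d) :
    P.real {ω | X t ω = x ∧ X s ω = y}
      = heatKernel p s 0 y * heatKernel p ((t : ℝ) - s) 0 (x - y) := by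
  have hi : IndepFun (X s) (X t - X s) P :=
    h.indep.indepFun_eval_sub (r := 0) zero_le hst (ae_of_all _ h.start)
  have h1 := hi.measure_inter_preimage_eq_mul {y} {x - y} (measurableSet_singleton _)
    (measurableSet_singleton _)
  have e : {ω | X t ω = x ∧ X s ω = y} = X s ⁻¹' {y} ∩ (X t - X s) ⁻¹' {x - y} := by
    ext ω
    simp only [Set.mem_ofPred_eq, Set.mem_inter_iff, Set.mem_preimage, Set.mem_singleton_iff,
      Pi.sub_apply]
    constructor
    · rintro ⟨rfl, rfl⟩; exact ⟨rfl, rfl⟩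
    · rintro ⟨rfl, h2⟩; exact ⟨sub_left_injective h2, rfl⟩
  rw [e, measureReal_def, h1, ENNReal.toReal_mul, ← h.measureReal_eq, ← h.increment_law s t hst]
  rfl

end Occupation

/-! ### Joint generating function of two occupation numbers -/

section Walkers

variable {d : ℕ} {Ω : Type*} [MeasurableSpace Ω] {P : Measure Ω}
  {p : Site d → Site d → ℝ} {ρ : ℝ≥0} {η₀ : Ω → Config d}
  {W : Site d × ℕ → ℝ≥0 → Ω → Site d}

/-- Once `F` contains the sites of all counted labels, further factors are 1. Finiteness matters
because `Set.ncard` is 0 on infinite sets. -/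
lemma eventually_prod_ite_eq_pow (n : Site d → ℕ) (Q : Site d × ℕ → Prop) [DecidablePred Q]
    (u : ℂ) (hfin : {i : Site d × ℕ | i.2 < n i.1 ∧ Q i}.Finite) :
    ∀ᶠ F : Finset (Site d) in atTop,
      ∏ z ∈ F, ∏ k ∈ Finset.range (n z), (if Q (z, k) then u else 1)
        = u ^ Set.ncard {i : Site d × ℕ | i.2 < n i.1 ∧ Q i} := by
  classical
  filter_upwards [eventually_ge_atTop (hfin.toFinset.image Prod.fst)] with F hF
  set r : Finset (Site d × ℕ) := (F.sigma fun z => Finset.range (n z)).map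
    (Equiv.sigmaEquivProd (Site d) ℕ).toEmbedding
  have hr (i : Site d × ℕ) : i ∈ r ↔ i.1 ∈ F ∧ i.2 ∈ Finset.range (n i.1) := by
    simp only [r, Finset.mem_map, Finset.mem_sigma, Equiv.coe_toEmbedding,
      Equiv.sigmaEquivProd_apply]
    constructor
    · rintro ⟨a, h, rfl⟩; exact h
    · intro h; exact ⟨⟨i.1, i.2⟩, h, rfl⟩
  rw [← Finset.prod_finset_product r F (fun z => Finset.range (n z)) hr
    (f := fun i => if Q i then u else 1), Finset.prod_ite, Finset.prod_const_one, mul_one,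
    Finset.prod_const]
  congr 1
  rw [← Set.ncard_coe_finset]
  congr 1
  ext i
  simp only [Finset.coe_filter, hr, Finset.mem_range, Set.mem_ofPred_eq]
  refine ⟨fun h => ⟨h.1.2, h.2⟩, fun h => ⟨⟨hF ?_, h.1⟩, h.2⟩⟩
  exact Finset.mem_image_of_mem _ (hfin.mem_toFinset.2 h)

lemma IsIndependentWalkers.measurableSet_occupied (hW : IsIndependentWalkers P p ρ η₀ W)
    (x : Site d) (i : Site d × ℕ) :
    MeasurableSet {q : ℝ≥0 × Ω | i.2 < η₀ q.2 i.1 ∧ i.1 + W i q.1 q.2 = x} := by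
  have h1 : Measurable fun q : ℝ≥0 × Ω => η₀ q.2 i.1 :=
    (measurable_pi_apply i.1).comp (hW.measurable_init.comp measurable_snd)
  have h2 := (hW.walk i).measurable_uncurry
  exact (h1 measurableSet_Ioi).inter
    (h2 (Set.to_countable {w : Site d | i.1 + w = x}).measurableSet)

lemma IsIndependentWalkers.measurable_walkersConfig (hW : IsIndependentWalkers P p ρ η₀ W)
    (x : Site d) : Measurable fun q : ℝ≥0 × Ω => walkersConfig η₀ W q.1 q.2 x :=
  measurable_ncard_setOf fun i => hW.measurableSet_occupied x i

lemma IsIndependentWalkers.measurable_walkersConfig_apply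
    (hW : IsIndependentWalkers P p ρ η₀ W) (t : ℝ≥0) (x : Site d) :
    Measurable fun ω => walkersConfig η₀ W t ω x :=
  (hW.measurable_walkersConfig x).comp measurable_prodMk_left

/-- Borel–Cantelli: the expected number of particles at `x` is $\sum_z\rho\,p_t(0,x-z)=\rho<\infty$.
Hence `Set.ncard` almost surely is the true count. -/
lemma IsIndependentWalkers.ae_finite [IsProbabilityMeasure P]
    (hW : IsIndependentWalkers P p ρ η₀ W) (t : ℝ≥0) (x : Site d) :
    ∀ᵐ ω ∂P, {i : Site d × ℕ | i.2 < η₀ ω i.1 ∧ i.1 + W i t ω = x}.Finite := by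
  refine ae_finite_setOfPred_mem (μ := P)
    (s := fun i => {ω | i.2 < η₀ ω i.1 ∧ i.1 + W i t ω = x}) ?_
  have e (i : Site d × ℕ) : P {ω | i.2 < η₀ ω i.1 ∧ i.1 + W i t ω = x}
      = P {ω | i.2 < η₀ ω i.1} * ENNReal.ofReal (heatKernel p t 0 (x - i.1)) := by
    have hi : IndepFun (fun ω => η₀ ω i.1) (W i t) P :=
      hW.init_indep.comp (measurable_pi_apply i.1)
        ((measurable_pi_apply t).comp (measurable_pi_apply i))
    have h := hi.measure_inter_preimage_eq_mul (Set.Ioi i.2) {x - i.1} measurableSet_Ioi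
      (measurableSet_singleton _)
    have e1 : {ω | i.2 < η₀ ω i.1 ∧ i.1 + W i t ω = x}
        = (fun ω => η₀ ω i.1) ⁻¹' Set.Ioi i.2 ∩ W i t ⁻¹' {x - i.1} := by
      ext ω
      simp [eq_sub_iff_add_eq']
    rw [e1, h, ← (hW.walk i).measureReal_eq, ofReal_measureReal]
    rfl
  simp_rw [e]
  rw [ENNReal.tsum_prod']
  simp_rw [ENNReal.tsum_mul_right, tsum_measure_lt hW.measurable_init hW.init_law,
    ENNReal.tsum_mul_left]
  have h1 := (hW.walk (0, 0)).hasSum_heatKernel t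
  have h2 : ∑' z, ENNReal.ofReal (heatKernel p t 0 (x - z)) = 1 := by
    refine ((Equiv.subLeft x).tsum_eq fun z => ENNReal.ofReal (heatKernel p t 0 z)).trans ?_
    rw [← ENNReal.ofReal_tsum_of_nonneg (fun z => ?_) h1.summable, h1.tsum_eq, ENNReal.ofReal_one]
    rw [← (hW.walk (0, 0)).measureReal_eq]
    exact measureReal_nonneg
  rw [h2, mul_one]
  exact ENNReal.coe_ne_top

/-- The joint generating function of two occupation numbers. -/
lemma IsIndependentWalkers.integral_pow_mul_pow [IsProbabilityMeasure P]
    (hW : IsIndependentWalkers P p ρ η₀ W) {s t : ℝ≥0} (hst : s ≤ t) (x y : Site d)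
    {u v : ℂ} (hu : ‖u‖ ≤ 1) (hv : ‖v‖ ≤ 1) :
    ∫ ω, u ^ walkersConfig η₀ W t ω x * v ^ walkersConfig η₀ W s ω y ∂P
      = Complex.exp (ρ * ((u - 1) + (v - 1)
        + (u - 1) * (v - 1) * heatKernel p ((t : ℝ) - s) 0 (x - y))) := by
  classical
  set V : Site d × ℕ → Ω → Site d × Site d := fun i ω => (W i t ω, W i s ω)
  have hV (i) : Measurable (V i) :=
    ((hW.walk i).measurable t).prodMk ((hW.walk i).measurable s)
  have hev : Measurable fun w : ℝ≥0 → Site d => (w t, w s) :=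
    (measurable_pi_apply t).prodMk (measurable_pi_apply s)
  have hind : iIndepFun V P := hW.walks_indep.comp (fun _ w => (w t, w s)) fun _ => hev
  have hind' : IndepFun η₀ (fun ω i => V i ω) P :=
    hW.init_indep.comp measurable_id
      (measurable_pi_lambda _ fun i => hev.comp (measurable_pi_apply i))
  set f : Site d → Site d × Site d → ℂ := fun z e =>
    (if z + e.1 = x then u else 1) * (if z + e.2 = y then v else 1)
  have hf (z) : Measurable (f z) := Measurable.of_discrete
  have hf1 (z e) : ‖f z e‖ ≤ 1 := by
    simp only [f, norm_mul]
    refine mul_le_one₀ ?_ (norm_nonneg _) ?_ <;> split_ifs <;> simp [hu, hv]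
  -- The expectation of $(1+(u-1)1_{\{\text{at }x\text{ at }t\}})(1+(v-1)1_{\{\text{at }y\text{ at
  -- }s\}})$ for a particle starting at `z`.
  set m : Site d → ℂ := fun z => 1 + ((u - 1) * heatKernel p t 0 (x - z)
    + (v - 1) * heatKernel p s 0 (y - z) + (u - 1) * (v - 1)
      * (heatKernel p s 0 (y - z) * heatKernel p ((t : ℝ) - s) 0 (x - y) : ℝ))
  have hm (z k) : ∫ ω, f z (V (z, k) ω) ∂P = m z := by
    have hA : MeasurableSet {ω | W (z, k) t ω = x - z} :=
      (hW.walk (z, k)).measurable t (measurableSet_singleton _)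
    have hB : MeasurableSet {ω | W (z, k) s ω = y - z} :=
      (hW.walk (z, k)).measurable s (measurableSet_singleton _)
    have e (ω) : f z (V (z, k) ω) = 1 + ({ω | W (z, k) t ω = x - z}.indicator (fun _ => u - 1) ω
        + {ω | W (z, k) s ω = y - z}.indicator (fun _ => v - 1) ω
        + ({ω | W (z, k) t ω = x - z} ∩ {ω | W (z, k) s ω = y - z}).indicator
          (fun _ => (u - 1) * (v - 1)) ω) := by
      simp only [f, V, Set.indicator, Set.mem_inter_iff, Set.mem_ofPred_eq, eq_sub_iff_add_eq']
      by_cases h1 : z + W (z, k) t ω = x <;> by_cases h2 : z + W (z, k) s ω = y <;>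
        simp [h1, h2]
      ring
    have hi (A : Set Ω) (hA : MeasurableSet A) (c : ℂ) :
        Integrable (A.indicator fun _ => c) P := (integrable_const c).indicator hA
    simp_rw [e]
    rw [integral_add (integrable_const _) (((hi _ hA _).fun_add (hi _ hB _)).fun_add
        (hi _ (hA.inter hB) _)), integral_add ((hi _ hA _).fun_add (hi _ hB _))
        (hi _ (hA.inter hB) _), integral_add (hi _ hA _) (hi _ hB _),
      integral_indicator_const _ hA, integral_indicator_const _ hB,
      integral_indicator_const _ (hA.inter hB), (hW.walk (z, k)).measureReal_eq,
      (hW.walk (z, k)).measureReal_eq]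
    have h3 := (hW.walk (z, k)).measureReal_eq_and hst (x - z) (y - z)
    rw [sub_sub_sub_cancel_right] at h3
    rw [show {ω | W (z, k) t ω = x - z} ∩ {ω | W (z, k) s ω = y - z}
      = {ω | W (z, k) t ω = x - z ∧ W (z, k) s ω = y - z} from rfl, h3]
    simp only [integral_const, probReal_univ, one_smul, Complex.real_smul, m]
    ring
  have hfin := integral_prod_marks hW.measurable_init hW.init_law hV hind hind' hf hf1 hm
  have hl : Tendsto (fun F : Finset (Site d) =>
      ∫ ω, ∏ z ∈ F, ∏ k ∈ Finset.range (η₀ ω z), f z (V (z, k) ω) ∂P) atTop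
      (𝓝 (∫ ω, u ^ walkersConfig η₀ W t ω x * v ^ walkersConfig η₀ W s ω y ∂P)) := by
    refine tendsto_integral_filter_of_dominated_convergence (fun _ => 1)
      (Eventually.of_forall fun F => ?_) (Eventually.of_forall fun F => ae_of_all _ fun ω => ?_)
      (integrable_const _) ?_
    · exact ((measurable_prod_marks hf F).comp
        (hW.measurable_init.prodMk (measurable_pi_lambda _ hV))).aestronglyMeasurable
    · exact norm_prod_marks_le hf1 F (η₀ ω, fun i => V i ω)
    · filter_upwards [hW.ae_finite t x, hW.ae_finite s y] with ω h1 h2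
      refine tendsto_const_nhds.congr' ?_
      filter_upwards [eventually_prod_ite_eq_pow (η₀ ω) (fun i => i.1 + W i t ω = x) u h1,
        eventually_prod_ite_eq_pow (η₀ ω) (fun i => i.1 + W i s ω = y) v h2] with F hF1 hF2
      rw [walkersConfig, walkersConfig, ← hF1, ← hF2, ← Finset.prod_mul_distrib]
      simp_rw [← Finset.prod_mul_distrib]
      rfl
  refine tendsto_nhds_unique hl ?_
  simp_rw [hfin, ← Complex.exp_sum, ← Finset.mul_sum]
  refine ((Complex.continuous_exp.tendsto _).comp (Tendsto.const_mul _ ?_))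
  have hs (r : ℝ≥0) (a : Site d) : HasSum (fun z => (heatKernel p r 0 (a - z) : ℂ)) 1 := by
    have : HasSum (fun z => heatKernel p r 0 (a - z)) 1 :=
      (Equiv.subLeft a).hasSum_iff.2 ((hW.walk (0, 0)).hasSum_heatKernel r)
    rw [← Complex.ofReal_one]
    exact Complex.hasSum_ofReal.2 this
  -- Summing over starting sites, each family of transition probabilities adds up to one: the
  -- Poisson measure is stationary, and only the transition from `y` to `x` survives.
  have key := (((hs t x).mul_left (u - 1)).add ((hs s y).mul_left (v - 1))).add
    (((hs s y).mul_right (heatKernel p ((t : ℝ) - s) 0 (x - y) : ℂ)).mul_left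
      ((u - 1) * (v - 1)))
  simp only [mul_one, one_mul] at key
  have key' := key.congr_fun (g := fun z => m z - 1) fun z => by
    simp only [m]
    push_cast
    ring
  exact key'

end Walkers

/-! ### Joint law and covariance of two occupation numbers -/

section Covariance

variable {d : ℕ} {Ω : Type*} [MeasurableSpace Ω] {P : Measure Ω}
  {p : Site d → Site d → ℝ} {ρ : ℝ≥0} {η₀ : Ω → Config d}
  {W : Site d × ℕ → ℝ≥0 → Ω → Site d}

lemma IsContinuousTimeWalk.heatKernel_nonneg {X : ℝ≥0 → Ω → Site d}
    (h : IsContinuousTimeWalk P p X) {t : ℝ} (ht : 0 ≤ t) (x : Site d) :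
    0 ≤ heatKernel p t 0 x := by
  lift t to ℝ≥0 using ht
  rw [← h.measureReal_eq]
  exact measureReal_nonneg

lemma IsContinuousTimeWalk.heatKernel_le_one [IsProbabilityMeasure P] {X : ℝ≥0 → Ω → Site d}
    (h : IsContinuousTimeWalk P p X) {t : ℝ} (ht : 0 ≤ t) (x : Site d) :
    heatKernel p t 0 x ≤ 1 := by
  lift t to ℝ≥0 using ht
  rw [← h.measureReal_eq]
  exact measureReal_le_one

lemma cexp_ofReal_mul_I_pow (a : ℝ) (n : ℕ) :
    Complex.exp ((a : ℂ) * Complex.I) ^ n = Complex.exp (((n : ℝ) * a : ℝ) * Complex.I) := by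
  rw [← Complex.exp_nat_mul]; push_cast; ring_nf

lemma IsIndependentWalkers.map_walkersConfig [IsProbabilityMeasure P] (hW : IsIndependentWalkers P p ρ η₀ W)
    (t : ℝ≥0) (x : Site d) :
    P.map (fun ω => (walkersConfig η₀ W t ω x : ℝ))
      = (poissonMeasure ρ).map (Nat.cast : ℕ → ℝ) := by
  have hm : Measurable fun ω => (walkersConfig η₀ W t ω x : ℝ) :=
    measurable_from_top.comp (hW.measurable_walkersConfig_apply t x)
  have : IsProbabilityMeasure (P.map fun ω => (walkersConfig η₀ W t ω x : ℝ)) :=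
    Measure.isProbabilityMeasure_map hm.aemeasurable
  refine Measure.ext_of_charFun (funext fun a => ?_)
  rw [charFun_map_cast_poissonMeasure, charFun_apply, integral_map hm.aemeasurable (by fun_prop)]
  have h := hW.integral_pow_mul_pow le_rfl (s := t) x x
    (u := Complex.exp (a * Complex.I)) (v := 1) (by rw [Complex.norm_exp_ofReal_mul_I]) (by simp)
  simp only [one_pow, mul_one, sub_self, add_zero, mul_zero, zero_mul,
    cexp_ofReal_mul_I_pow] at h
  simpa only [Real.inner_apply] using h

/-- Two occupation numbers are jointly distributed as `(A + B, A + C)` for independent Poisson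
variables `A`, `B`, `C`. -/
lemma IsIndependentWalkers.map_walkersConfig_pair [IsProbabilityMeasure P] (hW : IsIndependentWalkers P p ρ η₀ W)
    {s t : ℝ≥0} (hst : s ≤ t) (x y : Site d) {a b : ℝ≥0} (hab : a + b = ρ)
    (ha : (a : ℝ) = ρ * heatKernel p ((t : ℝ) - s) 0 (x - y)) :
    P.map (fun ω => ((walkersConfig η₀ W t ω x : ℝ), (walkersConfig η₀ W s ω y : ℝ)))
      = ((poissonMeasure a).prod ((poissonMeasure b).prod (poissonMeasure b))).map
        (fun q : ℕ × ℕ × ℕ => ((q.1 : ℝ) + q.2.1, (q.1 : ℝ) + q.2.2)) := by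
  have hm : Measurable fun ω =>
      ((walkersConfig η₀ W t ω x : ℝ), (walkersConfig η₀ W s ω y : ℝ)) :=
    (measurable_from_top.comp (hW.measurable_walkersConfig_apply t x)).prodMk
      (measurable_from_top.comp (hW.measurable_walkersConfig_apply s y))
  have hm' : Measurable fun q : ℕ × ℕ × ℕ => ((q.1 : ℝ) + q.2.1, (q.1 : ℝ) + q.2.2) :=
    Measurable.of_discrete
  have := Measure.isProbabilityMeasure_map (μ := P) hm.aemeasurable
  have := Measure.isProbabilityMeasure_map
    (μ := (poissonMeasure a).prod ((poissonMeasure b).prod (poissonMeasure b))) hm'.aemeasurable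
  refine Measure.ext_of_charFunDual (funext fun L => ?_)
  rw [charFunDual_apply, charFunDual_apply, integral_map hm.aemeasurable (by fun_prop),
    integral_map hm'.aemeasurable (by fun_prop)]
  set α := L (1, 0)
  set β := L (0, 1)
  have hL (r r' : ℝ) : L (r, r') = r * α + r' * β := by
    have : ((r, r') : ℝ × ℝ) = r • (1, 0) + r' • (0, 1) := by simp
    rw [this, map_add, map_smul, map_smul, smul_eq_mul, smul_eq_mul]
  set u := Complex.exp (α * Complex.I)
  set v := Complex.exp (β * Complex.I)
  have hu : ‖u‖ ≤ 1 := by simp only [u]; rw [Complex.norm_exp_ofReal_mul_I]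
  have hv : ‖v‖ ≤ 1 := by simp only [v]; rw [Complex.norm_exp_ofReal_mul_I]
  have huv (m n : ℕ) : Complex.exp ((L ((m : ℝ), (n : ℝ)) : ℝ) * Complex.I) = u ^ m * v ^ n := by
    rw [hL, cexp_ofReal_mul_I_pow, cexp_ofReal_mul_I_pow, ← Complex.exp_add]
    push_cast; ring_nf
  clear_value u v
  simp_rw [← Nat.cast_add, huv]
  rw [hW.integral_pow_mul_pow hst x y hu hv]
  have e (q : ℕ × ℕ × ℕ) : u ^ (q.1 + q.2.1) * v ^ (q.1 + q.2.2)
      = (u * v) ^ q.1 * (u ^ q.2.1 * v ^ q.2.2) := by ring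
  simp_rw [e]
  rw [integral_prod_mul (fun n : ℕ => (u * v) ^ n)
      (fun q : ℕ × ℕ => u ^ q.1 * v ^ q.2),
    integral_prod_mul (fun n : ℕ => u ^ n) (fun n : ℕ => v ^ n), integral_pow_poissonMeasure,
    integral_pow_poissonMeasure, integral_pow_poissonMeasure, ← Complex.exp_add,
    ← Complex.exp_add]
  -- With $b=\rho-a$, both exponents equal $\rho((u-1)+(v-1))+a(u-1)(v-1)$, because
  -- $uv-1=(u-1)(v-1)+(u-1)+(v-1)$.
  congr 1
  have h1 : ((a : ℝ) : ℂ) = ((ρ : ℝ) : ℂ) * heatKernel p ((t : ℝ) - s) 0 (x - y) := by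
    rw [ha]; push_cast; rfl
  have h2 : ((b : ℝ) : ℂ) = ((ρ : ℝ) : ℂ) - ((a : ℝ) : ℂ) := by rw [← hab]; push_cast; ring
  rw [h2]
  linear_combination (-(u - 1) * (v - 1)) * h1

lemma IsIndependentWalkers.integrable_charlierTwo_sq [IsProbabilityMeasure P] (hW : IsIndependentWalkers P p ρ η₀ W)
    (t : ℝ≥0) (x : Site d) :
    Integrable (fun ω => charlierTwo ρ (walkersConfig η₀ W t ω x) ^ 2) P := by
  have hm : Measurable fun ω => (walkersConfig η₀ W t ω x : ℝ) :=
    measurable_from_top.comp (hW.measurable_walkersConfig_apply t x)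
  have hc : AEStronglyMeasurable (fun r => charlierTwo ρ r ^ 2)
      (P.map fun ω => (walkersConfig η₀ W t ω x : ℝ)) :=
    ((continuous_charlierTwo ρ).pow 2).aestronglyMeasurable
  refine (integrable_map_measure hc hm.aemeasurable).1 ?_
  rw [hW.map_walkersConfig] at hc ⊢
  exact (integrable_map_measure hc (by fun_prop)).2 (_root_.integrable_charlierTwo_sq ρ ρ)

lemma IsIndependentWalkers.memLp_charlierTwo [IsProbabilityMeasure P] (hW : IsIndependentWalkers P p ρ η₀ W)
    (t : ℝ≥0) (x : Site d) :
    MemLp (fun ω => charlierTwo ρ (walkersConfig η₀ W t ω x)) 2 P := by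
  refine (memLp_two_iff_integrable_sq ?_).2 (hW.integrable_charlierTwo_sq t x)
  exact ((continuous_charlierTwo ρ).measurable.comp (measurable_from_top.comp
    (hW.measurable_walkersConfig_apply t x))).aestronglyMeasurable

/-- The space-time covariance of the second Charlier polynomials. -/
lemma IsIndependentWalkers.integral_charlierTwo_mul [IsProbabilityMeasure P] (hW : IsIndependentWalkers P p ρ η₀ W)
    {s t : ℝ≥0} (hst : s ≤ t) (x y : Site d) :
    ∫ ω, charlierTwo ρ (walkersConfig η₀ W t ω x) * charlierTwo ρ (walkersConfig η₀ W s ω y) ∂P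
      = 2 * (ρ : ℝ) ^ 2 * heatKernel p ((t : ℝ) - s) 0 (x - y) ^ 2 := by
  set q := heatKernel p ((t : ℝ) - s) 0 (x - y)
  have hts : 0 ≤ (t : ℝ) - s := sub_nonneg.2 hst
  have hq0 : 0 ≤ q := (hW.walk (0, 0)).heatKernel_nonneg hts _
  have hq1 : q ≤ 1 := (hW.walk (0, 0)).heatKernel_le_one hts _
  set a : ℝ≥0 := ρ * ⟨q, hq0⟩
  set b : ℝ≥0 := ρ * ⟨1 - q, sub_nonneg.2 hq1⟩
  have ha : (a : ℝ) = ρ * q := NNReal.coe_mul _ _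
  have hb : (b : ℝ) = ρ * (1 - q) := NNReal.coe_mul _ _
  have hab : a + b = ρ := by
    ext
    rw [NNReal.coe_add, ha, hb]
    ring
  have hlaw := hW.map_walkersConfig_pair hst x y hab ha
  have hm : Measurable fun ω =>
      ((walkersConfig η₀ W t ω x : ℝ), (walkersConfig η₀ W s ω y : ℝ)) :=
    (measurable_from_top.comp (hW.measurable_walkersConfig_apply t x)).prodMk
      (measurable_from_top.comp (hW.measurable_walkersConfig_apply s y))
  have hm' : Measurable fun q : ℕ × ℕ × ℕ => ((q.1 : ℝ) + q.2.1, (q.1 : ℝ) + q.2.2) :=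
    Measurable.of_discrete
  set G : ℝ × ℝ → ℝ := fun r => charlierTwo ρ r.1 * charlierTwo ρ r.2
  have hG : Continuous G := ((continuous_charlierTwo ρ).comp continuous_fst).mul
    ((continuous_charlierTwo ρ).comp continuous_snd)
  have hint : Integrable (G ∘ fun ω =>
      ((walkersConfig η₀ W t ω x : ℝ), (walkersConfig η₀ W s ω y : ℝ))) P :=
    (hW.memLp_charlierTwo t x).integrable_mul (hW.memLp_charlierTwo s y)
  rw [← integrable_map_measure hG.aestronglyMeasurable hm.aemeasurable, hlaw,
    integrable_map_measure hG.aestronglyMeasurable hm'.aemeasurable] at hint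
  have h1 := integral_map (μ := P) hm.aemeasurable (f := G) hG.aestronglyMeasurable
  rw [hlaw, integral_map hm'.aemeasurable hG.aestronglyMeasurable] at h1
  refine h1.symm.trans ?_
  have hρ : (ρ : ℝ) = a + b := by rw [← hab]; push_cast; rfl
  simp only [G, Function.comp_def, hρ] at hint ⊢
  rw [_root_.integral_charlierTwo_mul a b hint, ← hρ, ha]
  ring

end Covariance

/-! ### Fields of functions of the occupation numbers -/

section Fields

variable {d : ℕ} {Ω : Type*} [MeasurableSpace Ω] {P : Measure Ω}
  {p : Site d → Site d → ℝ} {ρ : ℝ≥0} {η₀ : Ω → Config d}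
  {W : Site d × ℕ → ℝ≥0 → Ω → Site d}

/-- The field `∑_x c_x (η_x (η_x - 1) - 2ρ(η_x - ρ) - ρ²)`. -/
def charlierField (ρ : ℝ≥0) (c : Site d → ℝ) (η : Config d) : ℝ :=
  ∑' x, c x * charlierTwo ρ (η x)

/-- By stationarity all occupation numbers have the same law, so the norms are $|c_x|$ times one
constant. This gives both the almost sure and the $L^2$ convergence of fields. -/
lemma IsIndependentWalkers.tsum_eLpNorm_ne_top [IsProbabilityMeasure P]
    (hW : IsIndependentWalkers P p ρ η₀ W)
    {c : Site d → ℝ} (hc : Summable fun x => |c x|) {g : ℝ → ℝ} (hg : Continuous g)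
    {q : ENNReal} (hgq : MemLp g q ((poissonMeasure ρ).map (Nat.cast : ℕ → ℝ))) (t : ℝ≥0) :
    ∑' x, eLpNorm (fun ω => c x * g (walkersConfig η₀ W t ω x)) q P ≠ ⊤ := by
  have e (x : Site d) : eLpNorm (fun ω => c x * g (walkersConfig η₀ W t ω x)) q P
      = ‖c x‖ₑ * eLpNorm g q ((poissonMeasure ρ).map (Nat.cast : ℕ → ℝ)) := by
    have hm : Measurable fun ω => (walkersConfig η₀ W t ω x : ℝ) :=
      measurable_from_top.comp (hW.measurable_walkersConfig_apply t x)
    rw [← hW.map_walkersConfig t x, eLpNorm_map_measure hg.aestronglyMeasurable hm.aemeasurable]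
    exact eLpNorm_const_smul (c x) _ q P
  simp_rw [e, ENNReal.tsum_mul_right]
  refine ENNReal.mul_ne_top ?_ hgq.eLpNorm_ne_top
  exact tsum_enorm_ne_top_iff_summable_norm.2 hc

lemma IsIndependentWalkers.ae_summable_field [IsProbabilityMeasure P]
    (hW : IsIndependentWalkers P p ρ η₀ W)
    {c : Site d → ℝ} (hc : Summable fun x => |c x|) {g : ℝ → ℝ} (hg : Continuous g)
    (hgi : Integrable (fun n : ℕ => g n) (poissonMeasure ρ)) (t : ℝ≥0) :
    ∀ᵐ ω ∂P, Summable fun x => ‖c x * g (walkersConfig η₀ W t ω x)‖ := by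
  refine summable_norm_of_tsum_eLpNorm_ne_top le_rfl (fun x => ?_)
    (hW.tsum_eLpNorm_ne_top hc hg (q := 1) ?_ t)
  · exact ((hg.measurable.comp (measurable_from_top.comp
      (hW.measurable_walkersConfig_apply t x))).const_mul (c x)).aestronglyMeasurable
  · rw [memLp_one_iff_integrable]
    exact (integrable_map_measure hg.aestronglyMeasurable (by fun_prop)).2 hgi

lemma integrable_charlierTwo (a : ℝ≥0) (r : ℝ) :
    Integrable (fun n : ℕ => charlierTwo r n) (poissonMeasure a) :=
  ((memLp_two_iff_integrable_sq (Measurable.of_discrete).aestronglyMeasurable).2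
    (_root_.integrable_charlierTwo_sq a r)).integrable one_le_two

/-- The series converges absolutely in $L^2$, and its $L^2$ sum agrees almost surely with the
pointwise one. -/
lemma IsIndependentWalkers.memLp_charlierField [IsProbabilityMeasure P]
    (hW : IsIndependentWalkers P p ρ η₀ W)
    {c : Site d → ℝ} (hc : Summable fun x => |c x|) (t : ℝ≥0) :
    MemLp (fun ω => charlierField ρ c (walkersConfig η₀ W t ω)) 2 P := by
  have hZ (x : Site d) := (hW.memLp_charlierTwo t x).const_mul (c x)
  have hg : MemLp (charlierTwo ρ) 2 ((poissonMeasure ρ).map (Nat.cast : ℕ → ℝ)) := by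
    refine (memLp_two_iff_integrable_sq (continuous_charlierTwo _).aestronglyMeasurable).2 ?_
    exact (integrable_map_measure (g := fun r => charlierTwo ρ r ^ 2)
      ((continuous_charlierTwo _).pow 2).aestronglyMeasurable (by fun_prop)).2
      (_root_.integrable_charlierTwo_sq ρ ρ)
  have hs : ∑' x, ‖(hZ x).toLp‖ₑ ≠ ⊤ := by
    simp_rw [Lp.enorm_toLp]
    exact hW.tsum_eLpNorm_ne_top hc (continuous_charlierTwo ρ) hg t
  refine (Lp.memLp (∑' x, (hZ x).toLp)).ae_eq ?_
  filter_upwards [Lp.coeFn_tsum hs, ae_all_iff.2 fun x => (hZ x).coeFn_toLp] with ω h1 h2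
  rw [h1, charlierField]
  exact tsum_congr h2

lemma IsIndependentWalkers.integral_abs_mul_le [IsProbabilityMeasure P]
    (hW : IsIndependentWalkers P p ρ η₀ W) (s t : ℝ≥0) (x y : Site d) :
    ∫ ω, |charlierTwo ρ (walkersConfig η₀ W t ω x) * charlierTwo ρ (walkersConfig η₀ W s ω y)| ∂P
      ≤ 2 * (ρ : ℝ) ^ 2 := by
  have hsq (t : ℝ≥0) (x : Site d) :
      ∫ ω, charlierTwo ρ (walkersConfig η₀ W t ω x) ^ 2 ∂P ≤ 2 * (ρ : ℝ) ^ 2 := by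
    simp_rw [sq (charlierTwo _ _)]
    rw [hW.integral_charlierTwo_mul le_rfl]
    refine mul_le_of_le_one_right (by positivity) (pow_le_one₀ ?_ ?_)
    · exact (hW.walk (0, 0)).heatKernel_nonneg (by simp) _
    · exact (hW.walk (0, 0)).heatKernel_le_one (by simp) _
  have h1 := hW.integrable_charlierTwo_sq t x
  have h2 := hW.integrable_charlierTwo_sq s y
  calc _ ≤ ∫ ω, (charlierTwo ρ (walkersConfig η₀ W t ω x) ^ 2
        + charlierTwo ρ (walkersConfig η₀ W s ω y) ^ 2) / 2 ∂P := by
        refine integral_mono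
          ((hW.memLp_charlierTwo t x).integrable_mul (hW.memLp_charlierTwo s y)).abs
          ((h1.add h2).div_const 2) fun ω => ?_
        simp only [abs_mul]
        have := two_mul_le_add_sq |charlierTwo ρ (walkersConfig η₀ W t ω x)|
          |charlierTwo ρ (walkersConfig η₀ W s ω y)|
        rw [sq_abs, sq_abs] at this
        linarith
    _ ≤ _ := by
        rw [integral_div, integral_add h1 h2]
        linarith [hsq t x, hsq s y]

/-- The space-time covariance of the second order field. -/
lemma IsIndependentWalkers.hasSum_covariance [IsProbabilityMeasure P]
    (hW : IsIndependentWalkers P p ρ η₀ W)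
    {c : Site d → ℝ} (hc : Summable fun x => |c x|) {s t : ℝ≥0} (hst : s ≤ t) :
    HasSum (fun q : Site d × Site d =>
        c q.1 * c q.2 * (2 * (ρ : ℝ) ^ 2 * heatKernel p ((t : ℝ) - s) 0 (q.1 - q.2) ^ 2))
      (∫ ω, charlierField ρ c (walkersConfig η₀ W t ω)
        * charlierField ρ c (walkersConfig η₀ W s ω) ∂P) := by
  set F : Site d × Site d → Ω → ℝ := fun q ω =>
    c q.1 * charlierTwo ρ (walkersConfig η₀ W t ω q.1)
      * (c q.2 * charlierTwo ρ (walkersConfig η₀ W s ω q.2))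
  have hF (q) : Integrable (F q) P :=
    ((hW.memLp_charlierTwo t q.1).const_mul _).integrable_mul
      ((hW.memLp_charlierTwo s q.2).const_mul _)
  have hcc : Summable fun q : Site d × Site d => |c q.1| * |c q.2| :=
    hc.mul_of_nonneg hc (fun _ => abs_nonneg _) fun _ => abs_nonneg _
  have hsum : Summable fun q => ∫ ω, ‖F q ω‖ ∂P := by
    refine Summable.of_nonneg_of_le (fun q => integral_nonneg fun ω => norm_nonneg _)
      (fun q => ?_) (hcc.mul_right (2 * (ρ : ℝ) ^ 2))
    have e (ω) : ‖F q ω‖ = |c q.1| * |c q.2| * |charlierTwo ρ (walkersConfig η₀ W t ω q.1)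
        * charlierTwo ρ (walkersConfig η₀ W s ω q.2)| := by
      simp only [F, Real.norm_eq_abs, abs_mul]; ring
    simp_rw [e]
    rw [integral_const_mul]
    exact mul_le_mul_of_nonneg_left (hW.integral_abs_mul_le s t _ _) (by positivity)
  have h := hasSum_integral_of_summable_integral_norm hF hsum
  have e1 (q) : ∫ ω, F q ω ∂P
      = c q.1 * c q.2 * (2 * (ρ : ℝ) ^ 2 * heatKernel p ((t : ℝ) - s) 0 (q.1 - q.2) ^ 2) := by
    rw [← hW.integral_charlierTwo_mul hst, ← integral_const_mul]
    congr 1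
    ext ω
    simp only [F]; ring
  have e2 : ∫ ω, ∑' q, F q ω ∂P = ∫ ω, charlierField ρ c (walkersConfig η₀ W t ω)
        * charlierField ρ c (walkersConfig η₀ W s ω) ∂P := by
    refine integral_congr_ae ?_
    filter_upwards [hW.ae_summable_field hc (continuous_charlierTwo ρ)
      (integrable_charlierTwo ρ ρ) t, hW.ae_summable_field hc (continuous_charlierTwo ρ)
      (integrable_charlierTwo ρ ρ) s] with ω h1 h2
    exact (tsum_mul_tsum_of_summable_norm h1 h2).symm
  simp_rw [e1] at h
  rwa [e2] at h

/-- The squared heat kernel is estimated in two ways: both factors by `B`, or one by `B` while the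
other sums to one over `y`. The first serves distinct macroscopic times, the second the time
integrals. -/
lemma IsIndependentWalkers.abs_covariance_le_of_le [IsProbabilityMeasure P]
    (hW : IsIndependentWalkers P p ρ η₀ W)
    {c : Site d → ℝ} (hc : Summable fun x => |c x|) (s t : ℝ≥0) :
    (∀ B, (∀ x, heatKernel p |(t : ℝ) - s| 0 x ≤ B) →
      |∫ ω, charlierField ρ c (walkersConfig η₀ W t ω)
        * charlierField ρ c (walkersConfig η₀ W s ω) ∂P|
      ≤ 2 * (ρ : ℝ) ^ 2 * B ^ 2 * (∑' x, |c x|) ^ 2) ∧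
    ∀ B M, (∀ x, heatKernel p |(t : ℝ) - s| 0 x ≤ B) → (∀ x, |c x| ≤ M) →
      |∫ ω, charlierField ρ c (walkersConfig η₀ W t ω)
        * charlierField ρ c (walkersConfig η₀ W s ω) ∂P|
      ≤ 2 * (ρ : ℝ) ^ 2 * M * B * ∑' x, |c x| := by
  wlog hst : s ≤ t generalizing s t
  · have := this t s (le_of_not_ge hst)
    rw [abs_sub_comm] at this
    simp_rw [mul_comm (charlierField ρ c (walkersConfig η₀ W t _))]
    exact this
  have hts : 0 ≤ (t : ℝ) - s := sub_nonneg.2 hst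
  rw [abs_of_nonneg hts]
  have hcov := hW.hasSum_covariance hc hst
  have hq0 (x : Site d) : 0 ≤ heatKernel p ((t : ℝ) - s) 0 x :=
    (hW.walk (0, 0)).heatKernel_nonneg hts x
  constructor
  · intro B hB
    have hcc : HasSum (fun q : Site d × Site d => |c q.1| * |c q.2| * (2 * (ρ : ℝ) ^ 2 * B ^ 2))
        ((∑' x, |c x|) * (∑' x, |c x|) * (2 * (ρ : ℝ) ^ 2 * B ^ 2)) :=
      (hc.hasSum.mul hc.hasSum
        (hc.mul_of_nonneg hc (fun _ => abs_nonneg _) fun _ => abs_nonneg _)).mul_right _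
    refine (hcov.norm_le_of_bounded hcc fun q => ?_).trans_eq (by ring)
    rw [norm_mul, norm_mul, Real.norm_eq_abs, Real.norm_eq_abs, Real.norm_of_nonneg (by positivity)]
    have := pow_le_pow_left₀ (hq0 (q.1 - q.2)) (hB (q.1 - q.2)) 2
    gcongr
  · intro B M hB hM
    have h1 := (hW.walk (0, 0)).hasSum_heatKernel (t - s)
    rw [NNReal.coe_sub hst] at h1
    have h2 := hc.hasSum.mul h1 (hc.mul_of_nonneg h1.summable (fun _ => abs_nonneg _) hq0)
    have h3 : HasSum (fun q : Site d × Site d =>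
        |c q.1| * heatKernel p ((t : ℝ) - s) 0 (q.1 - q.2)) ((∑' x, |c x|) * 1) :=
      -- The change of variables $(x,y)\mapsto(x,x-y)$ decouples the double sum.
      (Equiv.prodShear (Equiv.refl (Site d)) fun x => Equiv.subLeft x).hasSum_iff.2 h2
    refine (hcov.norm_le_of_bounded (h3.mul_left (2 * (ρ : ℝ) ^ 2 * M * B)) fun q => ?_).trans_eq
      (by ring)
    rw [norm_mul, norm_mul, Real.norm_eq_abs, Real.norm_eq_abs, Real.norm_of_nonneg
      (mul_nonneg (by positivity) (sq_nonneg _))]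
    have hM0 : 0 ≤ M := (abs_nonneg _).trans (hM 0)
    calc |c q.1| * |c q.2| * (2 * (ρ : ℝ) ^ 2 * heatKernel p ((t : ℝ) - s) 0 (q.1 - q.2) ^ 2)
        = 2 * (ρ : ℝ) ^ 2 * (|c q.2| * heatKernel p ((t : ℝ) - s) 0 (q.1 - q.2))
          * (|c q.1| * heatKernel p ((t : ℝ) - s) 0 (q.1 - q.2)) := by ring
      _ ≤ 2 * (ρ : ℝ) ^ 2 * (M * B)
          * (|c q.1| * heatKernel p ((t : ℝ) - s) 0 (q.1 - q.2)) := by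
          have := mul_le_mul (hM q.2) (hB (q.1 - q.2)) (hq0 _) hM0
          have := mul_nonneg (abs_nonneg (c q.1)) (hq0 (q.1 - q.2))
          gcongr
      _ = _ := by ring

end Fields

/-! ### Time integrals of second order processes -/

section TimeIntegrals

variable {Ω : Type*} [MeasurableSpace Ω] {P : Measure Ω} [IsProbabilityMeasure P]
  {X : ℝ → Ω → ℝ} {T B : ℝ}

/-- The inequality $2|ab|\le a^2+b^2$ and the uniform variance bound give joint integrability, the
input to every use of Fubini below. -/
lemma integrable_mul_of_bounded_variance (hX : Measurable fun q : ℝ × Ω => X q.1 q.2)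
    (hL : ∀ t, MemLp (X t) 2 P) (hB : ∀ t, ∫ ω, X t ω ^ 2 ∂P ≤ B) :
    Integrable (fun q : (ℝ × ℝ) × Ω => X q.1.1 q.2 * X q.1.2 q.2)
      (((volume.restrict (Set.Icc 0 T)).prod (volume.restrict (Set.Icc 0 T))).prod P) := by
  have hm : Measurable fun q : (ℝ × ℝ) × Ω => X q.1.1 q.2 * X q.1.2 q.2 :=
    (hX.comp ((measurable_fst.comp measurable_fst).prodMk measurable_snd)).mul
      (hX.comp ((measurable_snd.comp measurable_fst).prodMk measurable_snd))
  rw [integrable_prod_iff hm.aestronglyMeasurable]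
  refine ⟨ae_of_all _ fun q => (hL q.1).integrable_mul (hL q.2), ?_⟩
  refine Integrable.of_bound (C := B) ?_ (ae_of_all _ fun q => ?_)
  · exact (hm.norm.stronglyMeasurable.integral_prod_right).aestronglyMeasurable
  · rw [Real.norm_of_nonneg (integral_nonneg fun _ => norm_nonneg _)]
    have h1 := (hL q.1).integrable_sq
    have h2 := (hL q.2).integrable_sq
    calc ∫ ω, ‖X q.1 ω * X q.2 ω‖ ∂P ≤ ∫ ω, (X q.1 ω ^ 2 + X q.2 ω ^ 2) / 2 ∂P := by
          refine integral_mono ((hL q.1).integrable_mul (hL q.2)).norm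
            ((h1.add h2).div_const 2) fun ω => ?_
          simp only [norm_mul, Real.norm_eq_abs]
          have := two_mul_le_add_sq |X q.1 ω| |X q.2 ω|
          rw [sq_abs, sq_abs] at this
          linarith
      _ ≤ B := by
          rw [integral_div, integral_add h1 h2]
          linarith [hB q.1, hB q.2]

lemma ae_intervalIntegrable_of_bounded_variance (hT : 0 ≤ T)
    (hX : Measurable fun q : ℝ × Ω => X q.1 q.2)
    (hL : ∀ t, MemLp (X t) 2 P) (hB : ∀ t, ∫ ω, X t ω ^ 2 ∂P ≤ B) :
    ∀ᵐ ω ∂P, IntervalIntegrable (fun t => X t ω) volume 0 T := by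
  have hint : Integrable (fun q : ℝ × Ω => X q.1 q.2)
      ((volume.restrict (Set.Icc 0 T)).prod P) := by
    rw [integrable_prod_iff hX.aestronglyMeasurable]
    refine ⟨ae_of_all _ fun t => (hL t).integrable one_le_two, ?_⟩
    refine Integrable.of_bound (C := 1 + B) ?_ (ae_of_all _ fun t => ?_)
    · exact (hX.norm.stronglyMeasurable.integral_prod_right).aestronglyMeasurable
    · rw [Real.norm_of_nonneg (integral_nonneg fun _ => norm_nonneg _)]
      have h1 := (hL t).integrable_sq
      calc ∫ ω, ‖X t ω‖ ∂P ≤ ∫ ω, 1 + X t ω ^ 2 ∂P := by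
            refine integral_mono ((hL t).integrable one_le_two).norm
              ((integrable_const 1).add h1) fun ω => ?_
            simp only [Real.norm_eq_abs]
            nlinarith [sq_nonneg (|X t ω| - 1), sq_abs (X t ω), abs_nonneg (X t ω)]
        _ ≤ 1 + B := by
            rw [integral_add (integrable_const 1) h1]
            simpa using hB t
  filter_upwards [hint.prod_left_ae] with ω h
  rw [intervalIntegrable_iff_integrableOn_Icc_of_le hT]
  exact h

lemma intervalIntegral_eq_integral_Icc (hT : 0 ≤ T) (f : ℝ → ℝ) :
    ∫ t in (0 : ℝ)..T, f t = ∫ t in Set.Icc 0 T, f t := by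
  rw [intervalIntegral.integral_of_le hT, integral_Icc_eq_integral_Ioc]

lemma sq_intervalIntegral_eq (hT : 0 ≤ T) (f : ℝ → ℝ) :
    (∫ t in (0 : ℝ)..T, f t) ^ 2
      = ∫ q, f q.1 * f q.2
        ∂(volume.restrict (Set.Icc 0 T)).prod (volume.restrict (Set.Icc 0 T)) := by
  rw [integral_prod_mul f f, intervalIntegral_eq_integral_Icc hT, sq]

lemma memLp_intervalIntegral_of_bounded_variance (hT : 0 ≤ T)
    (hX : Measurable fun q : ℝ × Ω => X q.1 q.2)
    (hL : ∀ t, MemLp (X t) 2 P) (hB : ∀ t, ∫ ω, X t ω ^ 2 ∂P ≤ B) :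
    MemLp (fun ω => ∫ t in (0 : ℝ)..T, X t ω) 2 P := by
  have hm : AEStronglyMeasurable (fun ω => ∫ t in (0 : ℝ)..T, X t ω) P := by
    simp_rw [intervalIntegral_eq_integral_Icc hT]
    exact (hX.stronglyMeasurable.integral_prod_left').aestronglyMeasurable
  rw [memLp_two_iff_integrable_sq hm]
  simp_rw [sq_intervalIntegral_eq hT]
  exact (integrable_mul_of_bounded_variance hX hL hB).integral_prod_right

lemma integrable_covariance_of_bounded_variance
    (hX : Measurable fun q : ℝ × Ω => X q.1 q.2)
    (hL : ∀ t, MemLp (X t) 2 P) (hB : ∀ t, ∫ ω, X t ω ^ 2 ∂P ≤ B) :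
    Integrable (fun q : ℝ × ℝ => ∫ ω, X q.1 ω * X q.2 ω ∂P)
      ((volume.restrict (Set.Icc 0 T)).prod (volume.restrict (Set.Icc 0 T))) :=
  (integrable_mul_of_bounded_variance hX hL hB).integral_prod_left

lemma integral_sq_intervalIntegral (hT : 0 ≤ T)
    (hX : Measurable fun q : ℝ × Ω => X q.1 q.2)
    (hL : ∀ t, MemLp (X t) 2 P) (hB : ∀ t, ∫ ω, X t ω ^ 2 ∂P ≤ B) :
    ∫ ω, (∫ t in (0 : ℝ)..T, X t ω) ^ 2 ∂P
      = ∫ q, (∫ ω, X q.1 ω * X q.2 ω ∂P)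
        ∂(volume.restrict (Set.Icc 0 T)).prod (volume.restrict (Set.Icc 0 T)) := by
  simp_rw [sq_intervalIntegral_eq hT]
  exact (integral_integral_swap (integrable_mul_of_bounded_variance hX hL hB)).symm

lemma intervalIntegral_covariance_eq (hT : 0 ≤ T)
    (hX : Measurable fun q : ℝ × Ω => X q.1 q.2)
    (hL : ∀ t, MemLp (X t) 2 P) (hB : ∀ t, ∫ ω, X t ω ^ 2 ∂P ≤ B) :
    ∫ t in (0 : ℝ)..T, ∫ s in (0 : ℝ)..T, ∫ ω, X t ω * X s ω ∂P
      = ∫ q, (∫ ω, X q.1 ω * X q.2 ω ∂P)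
        ∂(volume.restrict (Set.Icc 0 T)).prod (volume.restrict (Set.Icc 0 T)) := by
  simp_rw [intervalIntegral_eq_integral_Icc hT]
  exact (integral_prod _ (integrable_covariance_of_bounded_variance hX hL hB)).symm

/-- Integrating a kernel that is at most `A` on the strip `|t - s| < ε` and at most `A b ε`
off it. -/
lemma integral_le_of_le_off_diagonal {K : ℝ × ℝ → ℝ} {A b ε : ℝ} (hT : 0 ≤ T) (hA : 0 ≤ A)
    (hb : 0 ≤ b) (hε : 0 ≤ ε)
    (hK : Integrable K ((volume.restrict (Set.Icc 0 T)).prod (volume.restrict (Set.Icc 0 T))))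
    (h1 : ∀ t ∈ Set.Icc 0 T, ∀ s ∈ Set.Icc 0 T, K (t, s) ≤ A)
    (h2 : ∀ t ∈ Set.Icc 0 T, ∀ s ∈ Set.Icc 0 T, ε ≤ |t - s| → K (t, s) ≤ A * (b * ε)) :
    ∫ q, K q ∂(volume.restrict (Set.Icc 0 T)).prod (volume.restrict (Set.Icc 0 T))
      ≤ A * (2 + b * T) * T * ε := by
  set S : Set (ℝ × ℝ) := {q | |q.1 - q.2| < ε}
  have hS : MeasurableSet S :=
    (isOpen_lt (by fun_prop) continuous_const).measurableSet
  set G : ℝ × ℝ → ℝ := fun q => A * (S.indicator (fun _ => 1) q + b * ε)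
  have hG : Integrable G
      ((volume.restrict (Set.Icc 0 T)).prod (volume.restrict (Set.Icc 0 T))) :=
    (((integrable_const 1).indicator hS).add (integrable_const _)).const_mul A
  have hle : K ≤ᵐ[(volume.restrict (Set.Icc 0 T)).prod (volume.restrict (Set.Icc 0 T))] G := by
    rw [Measure.prod_restrict]
    refine (ae_restrict_iff' (measurableSet_Icc.prod measurableSet_Icc)).2 (ae_of_all _ ?_)
    rintro ⟨t, s⟩ ⟨ht, hs⟩
    simp only [G]
    by_cases hq : (t, s) ∈ S
    · rw [Set.indicator_of_mem hq]
      have h3 : 0 ≤ A * (b * ε) := by positivity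
      linarith [h1 t ht s hs]
    · rw [Set.indicator_of_notMem hq, zero_add]
      exact h2 t ht s hs (not_lt.1 hq)
  refine (integral_mono_ae hK hG hle).trans ?_
  rw [integral_prod _ hG]
  -- The section of the strip at `t` is an interval of length at most `2 * ε`; the constant part
  -- contributes `b * ε * T`.
  calc ∫ t in Set.Icc 0 T, ∫ s in Set.Icc 0 T, G (t, s)
      ≤ ∫ _ in Set.Icc 0 T, A * (2 * ε + b * ε * T) := by
        refine integral_mono hG.integral_prod_left (integrable_const _) fun t => ?_
        simp only [G]
        have e (s : ℝ) : S.indicator (fun _ => (1 : ℝ)) (t, s)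
            = (Metric.ball t ε).indicator (fun _ => 1) s := by
          simp only [S, Set.indicator, Set.mem_ofPred_eq, Metric.mem_ball, Real.dist_eq,
            abs_sub_comm]
        simp_rw [e]
        rw [integral_const_mul, integral_add
          ((integrable_const _).indicator Metric.isOpen_ball.measurableSet) (integrable_const _),
          integral_indicator_const _ Metric.isOpen_ball.measurableSet]
        have hball : (volume.restrict (Set.Icc 0 T)).real (Metric.ball t ε) ≤ 2 * ε := by
          have : (volume.restrict (Set.Icc 0 T)) (Metric.ball t ε) ≤ ENNReal.ofReal (2 * ε) :=
            (Measure.restrict_apply_le _ _).trans_eq (Real.volume_ball t ε)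
          exact ENNReal.toReal_le_of_le_ofReal (by positivity) this
        have hconst : ∫ _ in Set.Icc 0 T, b * ε = b * ε * T := by
          rw [setIntegral_const, smul_eq_mul, Real.volume_real_Icc_of_le hT]; ring
        rw [hconst, smul_eq_mul, mul_one]
        gcongr
    _ = A * (2 + b * T) * T * ε := by
        rw [setIntegral_const, smul_eq_mul, Real.volume_real_Icc_of_le hT]; ring

end TimeIntegrals

/-! ### The fluctuation fields of the pair function -/

section PairFunction

variable {d : ℕ}

lemma integral_eval_poissonProduct (g : ℕ → ℝ) (r : ℝ≥0) :
    ∫ η : Config d, g (η 0) ∂poissonProduct d r = ∫ n, g n ∂poissonMeasure r := by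
  have h : MeasurePreserving (fun η : Config d => η 0) (poissonProduct d r) (poissonMeasure r) :=
    measurePreserving_eval_infinitePi _ 0
  rw [← h.map_eq, integral_map h.measurable.aemeasurable
    (Measurable.of_discrete).aestronglyMeasurable]

lemma meanAt_pairFunction (r : ℝ) : meanAt (pairFunction (d := d)) r = (r.toNNReal : ℝ) ^ 2 := by
  unfold meanAt pairFunction
  rw [integral_eval_poissonProduct fun n => (n : ℝ) * ((n : ℝ) - 1)]
  simp_rw [← cast_descFactorial_two]
  exact integral_descFactorial _ 2

lemma deriv_meanAt_pairFunction {r : ℝ} (hr : 0 < r) :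
    deriv (meanAt (pairFunction (d := d))) r = 2 * r := by
  -- `meanAt` clips negative densities to 0, so the square formula is used only near a positive
  -- density.
  have h : meanAt (pairFunction (d := d)) =ᶠ[𝓝 r] fun r => r ^ 2 := by
    filter_upwards [lt_mem_nhds hr] with r' hr'
    rw [meanAt_pairFunction, Real.coe_toNNReal _ hr'.le]
  rw [h.deriv_eq]
  simp

lemma densityProjection_pairFunction {ρ : ℝ≥0} (hρ : 0 < ρ) (η : Config d) :
    densityProjection ρ pairFunction η = 2 * ρ * ((η 0 : ℝ) - ρ) := by
  rw [densityProjection, deriv_meanAt_pairFunction (NNReal.coe_pos.2 hρ)]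

lemma meanAt_densityProjection {ρ : ℝ≥0} (hρ : 0 < ρ) :
    meanAt (densityProjection (d := d) ρ pairFunction) ρ = 0 := by
  unfold meanAt
  simp_rw [densityProjection_pairFunction hρ]
  rw [integral_eval_poissonProduct fun n => 2 * (ρ : ℝ) * ((n : ℝ) - ρ), integral_const_mul,
    Real.toNNReal_coe]
  have h := integrable_descFactorial ρ 1
  have h1 := integral_descFactorial ρ 1
  simp only [Nat.descFactorial_one, pow_one] at h h1
  rw [integral_sub h (integrable_const _), h1]
  simp

lemma fluctuationField_pairFunction (ρ : ℝ≥0) (N : ℕ) (φ : 𝓢(EuclideanSpace ℝ (Fin d), ℝ))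
    (η : Config d) :
    fluctuationField ρ N pairFunction φ η
      = ∑' x, φ (scaledPoint N x) * ((η x : ℝ) * ((η x : ℝ) - 1) - (ρ : ℝ) ^ 2) := by
  simp [fluctuationField, meanAt_pairFunction, pairFunction]

lemma fluctuationField_densityProjection {ρ : ℝ≥0} (hρ : 0 < ρ) (N : ℕ)
    (φ : 𝓢(EuclideanSpace ℝ (Fin d), ℝ)) (η : Config d) :
    fluctuationField ρ N (densityProjection ρ pairFunction) φ η
      = ∑' x, φ (scaledPoint N x) * (2 * ρ * ((η x : ℝ) - ρ)) := by
  simp [fluctuationField, meanAt_densityProjection hρ, densityProjection_pairFunction hρ]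

lemma secondOrderField_eq (ρ : ℝ≥0) (N : ℕ) (φ : 𝓢(EuclideanSpace ℝ (Fin d), ℝ))
    (η : Config d) :
    secondOrderField ρ N φ η = charlierField ρ (fun x => φ (scaledPoint N x)) η := by
  simp only [secondOrderField, charlierField, dualityPoly_two, charlierTwo]

variable {Ω : Type*} [MeasurableSpace Ω] {P : Measure Ω}
  {p : Site d → Site d → ℝ} {ρ : ℝ≥0} {η₀ : Ω → Config d}
  {W : Site d × ℕ → ℝ≥0 → Ω → Site d}

/-- Subtracting the projection on the density field leaves the second order field. -/
lemma IsIndependentWalkers.ae_fluctuationField_sub [IsProbabilityMeasure P]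
    (hW : IsIndependentWalkers P p ρ η₀ W) (hρ : 0 < ρ) {N : ℕ}
    (φ : 𝓢(EuclideanSpace ℝ (Fin d), ℝ))
    (hc : Summable fun x : Site d => |φ (scaledPoint N x)|) (t : ℝ≥0) :
    ∀ᵐ ω ∂P, fluctuationField ρ N pairFunction φ (walkersConfig η₀ W t ω)
        - fluctuationField ρ N (densityProjection ρ pairFunction) φ (walkersConfig η₀ W t ω)
      = secondOrderField ρ N φ (walkersConfig η₀ W t ω) := by
  have hd1 : Integrable (fun n : ℕ => (n : ℝ)) (poissonMeasure ρ) := by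
    simpa using integrable_descFactorial ρ 1
  have hd2 : Integrable (fun n : ℕ => (n : ℝ) * ((n : ℝ) - 1)) (poissonMeasure ρ) := by
    simpa only [cast_descFactorial_two] using integrable_descFactorial ρ 2
  have hi1 : Integrable (fun n : ℕ => (n : ℝ) * ((n : ℝ) - 1) - (ρ : ℝ) ^ 2) (poissonMeasure ρ) :=
    hd2.sub (integrable_const _)
  have hi2 : Integrable (fun n : ℕ => 2 * (ρ : ℝ) * ((n : ℝ) - ρ)) (poissonMeasure ρ) :=
    (hd1.sub (integrable_const _)).const_mul _
  have hc1 : Continuous fun r : ℝ => r * (r - 1) - (ρ : ℝ) ^ 2 := by fun_prop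
  have hc2 : Continuous fun r : ℝ => 2 * (ρ : ℝ) * (r - ρ) := by fun_prop
  filter_upwards [hW.ae_summable_field hc hc1 hi1 t, hW.ae_summable_field hc hc2 hi2 t]
    with ω h1 h2
  rw [fluctuationField_pairFunction, fluctuationField_densityProjection hρ, secondOrderField_eq,
    charlierField, ← h1.of_norm.tsum_sub h2.of_norm]
  refine tsum_congr fun x => ?_
  unfold charlierTwo
  ring

end PairFunction

/-! ### The rescaled process -/

section Rescaled

variable {d : ℕ} {Ω : Type*} [MeasurableSpace Ω] {P : Measure Ω}
  {p : Site d → Site d → ℝ} {ρ : ℝ≥0} {η₀ : Ω → Config d}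
  {W : Site d × ℕ → ℝ≥0 → Ω → Site d}

lemma IsIndependentWalkers.measurable_field_comp (hW : IsIndependentWalkers P p ρ η₀ W)
    (c : Site d → ℝ) {g : ℝ → ℝ} (hg : Continuous g) {r : ℝ → ℝ≥0} (hr : Measurable r) :
    Measurable fun q : ℝ × Ω => ∑' x, c x * g (walkersConfig η₀ W (r q.1) q.2 x) := by
  have h : Measurable fun q : ℝ × Ω => (r q.1, q.2) :=
    (hr.comp measurable_fst).prodMk measurable_snd
  have h1 (x : Site d) : Measurable fun q : ℝ × Ω => walkersConfig η₀ W (r q.1) q.2 x :=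
    (hW.measurable_walkersConfig x).comp h
  exact Measurable.tsum fun x =>
    (hg.measurable.comp (measurable_from_top.comp (h1 x))).const_mul (c x)

lemma measurable_toNNReal_mul (a : ℝ) : Measurable fun t : ℝ => Real.toNNReal (a * t) :=
  measurable_real_toNNReal.comp (measurable_const_mul a)

lemma IsIndependentWalkers.measurable_diffusiveField (hW : IsIndependentWalkers P p ρ η₀ W)
    (c : Site d → ℝ) {g : ℝ → ℝ} (hg : Continuous g) (N : ℕ) :
    Measurable fun q : ℝ × Ω => ∑' x, c x * g (diffusiveConfig η₀ W N q.1 q.2 x) := by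
  have h := hW.measurable_field_comp c hg (measurable_toNNReal_mul ((N : ℝ) ^ 2))
  unfold diffusiveConfig
  exact h

lemma abs_toNNReal_sub {N : ℕ} {t s : ℝ} (ht : 0 ≤ t) (hs : 0 ≤ s) :
    |((Real.toNNReal ((N : ℝ) ^ 2 * t) : ℝ≥0) : ℝ) - Real.toNNReal ((N : ℝ) ^ 2 * s)|
      = (N : ℝ) ^ 2 * |t - s| := by
  rw [Real.coe_toNNReal _ (by positivity), Real.coe_toNNReal _ (by positivity), ← mul_sub,
    abs_mul, abs_of_nonneg (by positivity)]

/-- Beyond the time scale `N ^ (-2d/(2+d))` the heat kernel at diffusive times is at most of the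
order of that scale. -/
lemma one_div_sqrt_pow_le {N : ℕ} (hN : 1 ≤ N) {τ : ℝ}
    (hτ : (N : ℝ) ^ (-(2 * (d : ℝ) / (2 + (d : ℝ)))) ≤ τ) :
    1 / √((N : ℝ) ^ 2 * τ) ^ d ≤ (N : ℝ) ^ (-(2 * (d : ℝ) / (2 + (d : ℝ)))) := by
  have hN0 : (0 : ℝ) < N := by exact_mod_cast hN
  have hd : (2 : ℝ) + d ≠ 0 := by positivity
  -- Here $2-2d/(2+d)=4/(2+d)$, whose half is the exponent; its `d`-th power is the inverse of the
  -- time scale, which is the balance that fixes this scale.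
  have h1 : (N : ℝ) ^ (2 / (2 + (d : ℝ))) ≤ √((N : ℝ) ^ 2 * τ) := by
    refine Real.le_sqrt_of_sq_le ?_
    calc ((N : ℝ) ^ (2 / (2 + (d : ℝ)))) ^ 2
        = (N : ℝ) ^ 2 * (N : ℝ) ^ (-(2 * (d : ℝ) / (2 + (d : ℝ)))) := by
          rw [← Real.rpow_natCast, ← Real.rpow_natCast, ← Real.rpow_mul hN0.le,
            ← Real.rpow_add hN0]
          congr 1
          push_cast
          field_simp
          ring
      _ ≤ _ := by gcongr
  have h2 : ((N : ℝ) ^ (2 / (2 + (d : ℝ)))) ^ d = (N : ℝ) ^ (2 * (d : ℝ) / (2 + (d : ℝ))) := by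
    rw [← Real.rpow_natCast, ← Real.rpow_mul hN0.le]
    congr 1
    ring
  rw [Real.rpow_neg hN0.le, ← one_div, ← h2]
  exact one_div_le_one_div_of_le (by positivity) (pow_le_pow_left₀ (by positivity) h1 d)

end Rescaled

end

/-! ### Assembly of the three estimates -/

theorem corollary3p2 {d : ℕ} (hd : 0 < d) (p : Site d → Site d → ℝ) (hp : IsJumpKernel p)
    (ρ : ℝ≥0) (hρ : 0 < ρ) (φ : 𝓢(EuclideanSpace ℝ (Fin d), ℝ)) :
    ∃ (C : ℝ → ℝ) (N₀ : ℝ → ℕ) (K : ℝ) (N₁ : ℕ),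
    ∀ {Ω : Type*} [MeasurableSpace Ω] (P : Measure Ω) [IsProbabilityMeasure P]
      (η₀ : Ω → Config d) (W : Site d × ℕ → ℝ≥0 → Ω → Site d),
      IsIndependentWalkers P p ρ η₀ W →
    let η : ℕ → ℝ → Ω → Config d := diffusiveConfig η₀ W
    let X : ℕ → ℝ → Ω → ℝ := fun N t ω => secondOrderField ρ N φ (η N t ω)
    let Y : ℕ → ℝ → Ω → ℝ := fun N t ω =>
      fluctuationField ρ N pairFunction φ (η N t ω)
        - fluctuationField ρ N (densityProjection ρ pairFunction) φ (η N t ω)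
    -- the bound on the space-time covariance
    (∀ T : ℝ, 0 < T → ∀ N : ℕ, N₀ T ≤ N →
      (∀ t : ℝ, 0 ≤ t → MemLp (X N t) 2 P) ∧
      IntegrableOn (fun q : ℝ × ℝ => ∫ ω, X N q.1 ω * X N q.2 ω ∂P)
        (Set.Icc 0 T ×ˢ Set.Icc 0 T) ∧
      (1 / (N : ℝ) ^ d) * (∫ t in (0 : ℝ)..T, ∫ s in (0 : ℝ)..T, ∫ ω, X N t ω * X N s ω ∂P)
        ≤ C T * (N : ℝ) ^ (-(2 * (d : ℝ) / (2 + (d : ℝ))))) ∧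
    -- the quantitative Boltzmann-Gibbs principle for `η_0 (η_0 - 1)`
    (∀ T : ℝ, 0 < T → ∀ N : ℕ, N₀ T ≤ N →
      (∀ᵐ ω ∂P, IntervalIntegrable (fun t => Y N t ω) volume 0 T) ∧
      MemLp (fun ω => ∫ t in (0 : ℝ)..T, Y N t ω) 2 P ∧
      (∫ ω, ((1 / (N : ℝ) ^ ((d : ℝ) / 2)) * ∫ t in (0 : ℝ)..T, Y N t ω) ^ 2 ∂P)
        ≤ C T * (N : ℝ) ^ (-(2 * (d : ℝ) / (2 + (d : ℝ))))) ∧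
    -- the covariance at distinct macroscopic times is of order one
    (∀ N : ℕ, N₁ ≤ N → ∀ t s : ℝ, 0 ≤ t → 0 ≤ s → t ≠ s →
      |∫ ω, X N t ω * X N s ω ∂P| ≤ K / |t - s| ^ d) := by
  obtain ⟨c, hc, hker⟩ := hp.exists_heatKernel_le
  obtain ⟨S, hS, hlat⟩ := exists_lattice_sum_le φ
  obtain ⟨M, hM, hφM⟩ := exists_abs_schwartz_le_const φ
  set A : ℝ := 2 * (ρ : ℝ) ^ 2 * M * S with hA
  have hA0 : 0 ≤ A := by positivity
  -- `C T` is the constant of `integral_le_of_le_off_diagonal` with `b = c`; `K` comes from bounding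
  -- both heat kernel factors. All estimates hold from `N = 1` on.
  refine ⟨fun T => A * (2 + c * T) * T, fun _ => 1, 2 * (ρ : ℝ) ^ 2 * c ^ 2 * S ^ 2, 1, ?_⟩
  intro Ω _ P _ η₀ W hW η X Y
  have hX (N : ℕ) (t : ℝ) (ω : Ω) : X N t ω = charlierField ρ (fun x => φ (scaledPoint N x))
      (walkersConfig η₀ W (Real.toNNReal ((N : ℝ) ^ 2 * t)) ω) := secondOrderField_eq _ _ _ _
  have hXm (N : ℕ) : Measurable fun q : ℝ × Ω => X N q.1 q.2 := by
    simp_rw [hX]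
    exact hW.measurable_diffusiveField _ (continuous_charlierTwo ρ) N
  have hYm (N : ℕ) : Measurable fun q : ℝ × Ω => Y N q.1 q.2 := by
    simp only [Y, fluctuationField_pairFunction, fluctuationField_densityProjection hρ]
    exact (hW.measurable_diffusiveField _
        (g := fun r => r * (r - 1) - (ρ : ℝ) ^ 2) (by fun_prop) N).sub
      (hW.measurable_diffusiveField _ (g := fun r => 2 * ρ * (r - ρ)) (by fun_prop) N)
  have hXL (N : ℕ) (hN : 1 ≤ N) (t : ℝ) : MemLp (X N t) 2 P := by
    have : X N t = fun ω => _ := funext fun ω => hX N t ω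
    rw [this]
    exact hW.memLp_charlierField (hlat N hN).1 _
  -- `Real.toNNReal` sends negative times to time 0, so the bounds hold for all real `t` and `s`, as
  -- the lemmas on time integrals require.
  have hcov (N : ℕ) (hN : 1 ≤ N) (t s : ℝ) (B : ℝ) (hB0 : 0 ≤ B)
      (hB : ∀ x, heatKernel p |((Real.toNNReal ((N : ℝ) ^ 2 * t) : ℝ≥0) : ℝ)
        - Real.toNNReal ((N : ℝ) ^ 2 * s)| 0 x ≤ B) :
      |∫ ω, X N t ω * X N s ω ∂P| ≤ A * (N : ℝ) ^ d * B ∧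
      |∫ ω, X N t ω * X N s ω ∂P| ≤ 2 * (ρ : ℝ) ^ 2 * B ^ 2 * (S * (N : ℝ) ^ d) ^ 2 := by
    simp_rw [hX]
    obtain ⟨hs, hle⟩ := hlat N hN
    have h := hW.abs_covariance_le_of_le hs (Real.toNNReal ((N : ℝ) ^ 2 * s))
      (Real.toNNReal ((N : ℝ) ^ 2 * t))
    have h0 : 0 ≤ ∑' x : Site d, |φ (scaledPoint N x)| := tsum_nonneg fun _ => abs_nonneg _
    constructor
    · refine (h.2 B M hB fun x => hφM _).trans ?_
      calc _ ≤ 2 * (ρ : ℝ) ^ 2 * M * B * (S * (N : ℝ) ^ d) := by gcongr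
        _ = _ := by rw [hA]; ring
    · refine (h.1 B hB).trans ?_
      gcongr
  have hone (N : ℕ) (hN : 1 ≤ N) (t s : ℝ) :
      |∫ ω, X N t ω * X N s ω ∂P| ≤ A * (N : ℝ) ^ d := by
    simpa using (hcov N hN t s 1 zero_le_one fun x =>
      (hW.walk (0, 0)).heatKernel_le_one (abs_nonneg _) x).1
  have hvar (N : ℕ) (hN : 1 ≤ N) (t : ℝ) : ∫ ω, X N t ω ^ 2 ∂P ≤ A * (N : ℝ) ^ d := by
    simpa only [sq] using (le_abs_self _).trans (hone N hN t t)
  have hkerN (N : ℕ) (hN : 1 ≤ N) {t s : ℝ} (ht : 0 ≤ t) (hs : 0 ≤ s) (hts : 0 < |t - s|)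
      (x : Site d) : heatKernel p |((Real.toNNReal ((N : ℝ) ^ 2 * t) : ℝ≥0) : ℝ)
        - Real.toNNReal ((N : ℝ) ^ 2 * s)| 0 x ≤ c / √((N : ℝ) ^ 2 * |t - s|) ^ d := by
    have hN0 : (0 : ℝ) < N := by exact_mod_cast hN
    rw [abs_toNNReal_sub ht hs]
    exact hker _ (by positivity) x
  have hmain (N : ℕ) (hN : 1 ≤ N) (T : ℝ) (hT : 0 < T) :
      ∫ q, (∫ ω, X N q.1 ω * X N q.2 ω ∂P)
        ∂(volume.restrict (Set.Icc 0 T)).prod (volume.restrict (Set.Icc 0 T))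
      ≤ (N : ℝ) ^ d * (A * (2 + c * T) * T * (N : ℝ) ^ (-(2 * (d : ℝ) / (2 + (d : ℝ))))) := by
    have hN0 : (0 : ℝ) < N := by exact_mod_cast hN
    have hε : 0 < (N : ℝ) ^ (-(2 * (d : ℝ) / (2 + (d : ℝ)))) := by positivity
    refine (integral_le_of_le_off_diagonal (A := A * (N : ℝ) ^ d) (b := c) hT.le (by positivity)
      hc.le hε.le
      (integrable_covariance_of_bounded_variance (hXm N) (hXL N hN) (hvar N hN))
      (fun t _ s _ => (le_abs_self _).trans (hone N hN t s))
      fun t ht s hs hts => (le_abs_self _).trans ?_).trans_eq (by ring)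
    refine (hcov N hN t s (c / √((N : ℝ) ^ 2 * |t - s|) ^ d) (by positivity)
      (hkerN N hN ht.1 hs.1 (hε.trans_le hts))).1.trans ?_
    rw [div_eq_mul_one_div c]
    have := one_div_sqrt_pow_le hN hts
    gcongr
  refine ⟨fun T hT N hN => ⟨fun t _ => hXL N hN t, ?_, ?_⟩, fun T hT N hN => ?_,
    fun N hN t s ht hs hts => ?_⟩
  · have := integrable_covariance_of_bounded_variance (T := T) (hXm N) (hXL N hN) (hvar N hN)
    rwa [Measure.prod_restrict] at this
  · have hN0 : (0 : ℝ) < N := by exact_mod_cast hN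
    rw [intervalIntegral_covariance_eq hT.le (hXm N) (hXL N hN) (hvar N hN), one_div,
      inv_mul_le_iff₀ (by positivity)]
    exact hmain N hN T hT
  · have hN0 : (0 : ℝ) < N := by exact_mod_cast hN
    -- The identity is almost sure for each fixed time. Joint measurability exchanges the
    -- quantifiers, and agreement at almost every time suffices for time integrals.
    have hae : ∀ᵐ ω ∂P, ∀ᵐ t : ℝ, Y N t ω = X N t ω := by
      refine (Measure.ae_ae_comm (p := fun t ω => Y N t ω = X N t ω)
        (measurableSet_eq_fun (hYm N) (hXm N))).1 ?_
      exact ae_of_all _ fun t => hW.ae_fluctuationField_sub hρ φ (hlat N hN).1 _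
    have hint : (fun ω => ∫ t in (0 : ℝ)..T, Y N t ω) =ᵐ[P] fun ω => ∫ t in (0 : ℝ)..T, X N t ω := by
      filter_upwards [hae] with ω hω
      exact intervalIntegral.integral_congr_ae (hω.mono fun t ht _ => ht)
    refine ⟨?_, ?_, ?_⟩
    · filter_upwards [hae, ae_intervalIntegrable_of_bounded_variance hT.le (hXm N) (hXL N hN)
        (hvar N hN)] with ω hω h
      exact h.congr_ae (ae_restrict_of_ae (hω.mono fun t ht => ht.symm))
    · exact (memLp_intervalIntegral_of_bounded_variance hT.le (hXm N) (hXL N hN)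
        (hvar N hN)).ae_eq hint.symm
    · have e : ∫ ω, ((1 / (N : ℝ) ^ ((d : ℝ) / 2)) * ∫ t in (0 : ℝ)..T, Y N t ω) ^ 2 ∂P
          = ((N : ℝ) ^ d)⁻¹ * ∫ ω, (∫ t in (0 : ℝ)..T, X N t ω) ^ 2 ∂P := by
        rw [← integral_const_mul]
        refine integral_congr_ae ?_
        filter_upwards [hint] with ω hω
        have hpow : ((N : ℝ) ^ ((d : ℝ) / 2)) ^ 2 = (N : ℝ) ^ d := by
          rw [← Real.rpow_natCast, ← Real.rpow_natCast, ← Real.rpow_mul hN0.le]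
          congr 1
          push_cast
          ring
        rw [hω, mul_pow, one_div, inv_pow, hpow]
      rw [e, integral_sq_intervalIntegral hT.le (hXm N) (hXL N hN) (hvar N hN),
        inv_mul_le_iff₀ (by positivity)]
      exact hmain N hN T hT
  · have hN0 : (0 : ℝ) < N := by exact_mod_cast hN
    have hτ : 0 < |t - s| := abs_pos.2 (sub_ne_zero.2 hts)
    refine (hcov N hN t s (c / √((N : ℝ) ^ 2 * |t - s|) ^ d) (by positivity)
      (hkerN N hN ht hs hτ)).2.trans_eq ?_
    -- The squared heat kernel bound is $c^2/(N^2|t-s|)^d$, whose $N^{-2d}$ cancels the square of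
    -- the lattice sum.
    rw [div_pow, ← pow_mul, mul_comm d 2, pow_mul, Real.sq_sqrt (by positivity), mul_pow, mul_pow]
    field_simp
    ring
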